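/- \textbf{Theorem (Two characterisations of trivialisable systems).} All objects are $C^\infty$. Let $\mathcal M$ be an $n$-dimensional manifold, $m\ge 1$, and let $\Sigma=(f,g)$ be the control-affine system $\dot\xi=f(\xi)+\sum_{i=1}^m g_i(\xi)u_i$ given by vector fields $f,g_1,\dots,g_m$ on $\mathcal M$. Put $\mathcal G=\mathrm{span}\{g_1,\dots,g_m\}$, $\mathcal G^1=\mathrm{span}\{g_1,\dots,g_m,[f,g_1],\dots,[f,g_m]\}$ and $\mathcal A=f+\mathcal G$ (pointwise). Systems $\Sigma$ on $\mathcal M$ and $\tilde\Sigma=(\tilde f,\tilde g)$ on $\tilde{\mathcal M}$, both with $m$ controls, are locally feedback equivalent at $\xi_0$ and $\tilde\xi_0$ if there are a diffeomorphism $\phi$ from an open neighbourhood $U$ of $\xi_0$ onto an open subset of $\tilde{\mathcal M}$ with $\phi(\xi_0)=\tilde\xi_0$, and smooth maps $\alpha:U\to\mathbb R^m$, $\beta:U\to GL_m(\mathbb R)$, such that $\tilde f=\phi_*\big(f+\sum_i\alpha_i g_i\big)$ and $\tilde g_i=\phi_*\big(\sum_j\beta_i^j g_j\big)$ on $\phi(U)$.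 The system $\Sigma$ is locally trivialisable at $\xi_0$ if it is locally feedback equivalent, at $\xi_0$ and some point $(x_0,w_0)$, to a system $\dot x=F(w)$, $\dot w=u$ on $\mathbb R^{n-m}\times\mathbb R^m$ with $F$ smooth. A vector field $v$ on an open set $U\subset\mathcal M$ is an infinitesimal symmetry of $\Sigma$ on $U$ if its local flow $\gamma^v_t$ in $U$ satisfies $(\gamma^v_t)_*\mathcal A=\mathcal A$ for all $t$ for which it exists. Let $\xi_0\in\mathcal M$. (i) Let $k\geq 0$ be an integer and suppose that $\mathrm{rk}\,\mathcal G^1=m+k$ is constant in a neighbourhood of $\xi_0$. Then $\Sigma$ is locally trivialisable at $\xi_0$ if and only if it is locally feedback equivalent, at $\xi_0$ and some point $(x_0,w_0)$, to a system $$\dot x_i=h_i(x,w),\quad 1\le i\le n-m,\qquad \dot w=u$$ on $\mathbb R^{n-m}\times\mathbb R^m$, where the smooth functions $h_1,\dots,h_{n-m}$ satisfy $\mathrm{rk}\,\mathrm{span}\{dh_1,\dots,dh_{n-m}\}=k$ in a neighbourhood of $(x_0,w_0)$. (ii) $\Sigma$ is locally trivialisable at $\xi_0$ if and only if there is an open neighbourhood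 $U$ of $\xi_0$ on which $\mathcal G$ is involutive and of constant rank $m$ and on which the Lie algebra of infinitesimal symmetries of $\Sigma$ possesses an abelian subalgebra $\mathfrak A$ (a real vector space of pairwise commuting infinitesimal symmetries on $U$) with $\mathfrak A(\xi_0)\oplus\mathcal G(\xi_0)=T_{\xi_0}\mathcal M$, where $\mathfrak A(\xi_0)=\{v(\xi_0):v\in\mathfrak A\}$. -/

import Mathlib

open scoped Manifold ContDiff Topology

noncomputable section

namespace ControlAffine

section General

variable {E : Type*} [NormedAddCommGroup E] [NormedSpace ℝ E]
  {H : Type*} [TopologicalSpace H] {I : ModelWithCorners ℝ E H}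
  {M : Type*} [TopologicalSpace M] [ChartedSpace H M]
  {E' : Type*} [NormedAddCommGroup E'] [NormedSpace ℝ E']
  {H' : Type*} [TopologicalSpace H'] {I' : ModelWithCorners ℝ E' H'}
  {M' : Type*} [TopologicalSpace M'] [ChartedSpace H' M']
  {m : ℕ}

/-- The vector field `v` is `C^∞` on the set `U`. -/
def SmoothFieldOn (I : ModelWithCorners ℝ E H) {M : Type*} [TopologicalSpace M]
    [ChartedSpace H M] [IsManifold I ∞ M] (v : (x : M) → TangentSpace I x) (U : Set M) : Prop :=
  ContMDiffOn I I.tangent ∞ (fun x => (⟨x, v x⟩ : TangentBundle I M)) U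

/-- A control-affine system `ξ' = f(ξ) + ∑ i, u i • g i (ξ)` with `m` scalar controls and smooth
vector fields `f, g 0, …, g (m - 1)` on the manifold `M`. -/
structure System (I : ModelWithCorners ℝ E H) (M : Type*) [TopologicalSpace M]
    [ChartedSpace H M] [IsManifold I ∞ M] (m : ℕ) where
  /-- the drift -/
  f : (x : M) → TangentSpace I x
  /-- the controlled vector fields -/
  g : Fin m → (x : M) → TangentSpace I x
  smooth_f : SmoothFieldOn I f Set.univ
  smooth_g : ∀ i, SmoothFieldOn I (g i) Set.univ

variable [IsManifold I ∞ M] [IsManifold I' ∞ M']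

namespace System

/-- The distribution `𝒢 = span {g_1, …, g_m}`. -/
def G (S : System I M m) (x : M) : Submodule ℝ (TangentSpace I x) :=
  Submodule.span ℝ (Set.range fun i => S.g i x)

/-- The distribution `𝒢¹ = span {g_1, …, g_m, [f, g_1], …, [f, g_m]}`. -/
def G1 (S : System I M m) (x : M) : Submodule ℝ (TangentSpace I x) :=
  S.G x ⊔ Submodule.span ℝ (Set.range fun i => VectorField.mlieBracket I S.f (S.g i) x)

/-- The affine space of admissible velocities `𝒜(x) = {f(x) + ∑ i, u i • g i (x)}`. -/
def A (S : System I M m) (x : M) : Set (TangentSpace I x) :=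
  {y | ∃ u : Fin m → ℝ, y = S.f x + ∑ i, u i • S.g i x}

/-- Local feedback equivalence of `S` at `x₀` and `S'` at `x₀'`: a diffeomorphism `φ` from an open
neighbourhood of `x₀` onto an open subset of `M'`, with `φ x₀ = x₀'`, and smooth feedback functions
`α` (with values in `ℝ^m`) and `β` (with values in `GL_m(ℝ)`) such that
`f' = φ_* (f + ∑ i, α i • g i)` and `g' i = φ_* (∑ j, β i j • g j)`. -/
def LocallyFeedbackEquivalent (S : System I M m) (x₀ : M) (S' : System I' M' m) (x₀' : M') :
    Prop :=
  ∃ (φ : PartialDiffeomorph I I' M M' ∞) (α : M → Fin m → ℝ) (β : M → GL (Fin m) ℝ),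
    x₀ ∈ φ.source ∧ φ x₀ = x₀' ∧
    (∀ i, ContMDiffOn I 𝓘(ℝ, ℝ) ∞ (fun x => α x i) φ.source) ∧
    (∀ i j, ContMDiffOn I 𝓘(ℝ, ℝ) ∞ (fun x => (β x).val i j) φ.source) ∧
    ∀ x ∈ φ.source,
      S'.f (φ x) = mfderiv I I' φ x (S.f x + ∑ i, α x i • S.g i x) ∧
      ∀ i, S'.g i (φ x) = mfderiv I I' φ x (∑ j, (β x).val i j • S.g j x)

/-- On the open set `U` the distribution `𝒢` is involutive: the Lie bracket of two smooth vector
fields on `U` that are tangent to `𝒢` is tangent to `𝒢`. -/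
def InvolutiveOn (S : System I M m) (U : Set M) : Prop :=
  ∀ X Y : (x : M) → TangentSpace I x, SmoothFieldOn I X U → SmoothFieldOn I Y U →
    (∀ x ∈ U, X x ∈ S.G x) → (∀ x ∈ U, Y x ∈ S.G x) →
    ∀ x ∈ U, VectorField.mlieBracket I X Y x ∈ S.G x

/-- `φ` is a local symmetry on the open set `W`: a local diffeomorphism there, with
`φ_* 𝒜 = 𝒜`. -/
def IsLocalSymmetryOn (S : System I M m) (φ : M → M) (W : Set M) : Prop :=
  IsLocalDiffeomorphOn I I ∞ φ W ∧ ∀ x ∈ W, mfderiv I I φ x '' S.A x = S.A (φ x)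

end System

/-- `γ t x`, for `t ∈ (a, b)` (an interval that contains `0`) and `x` in the open set `W`, is the
flow of the vector field `v` on `U`: the curve `t ↦ γ t x` is the integral curve of `v` in `U`
with value `x` at `t = 0`. -/
structure IsLocalFlow (v : (x : M) → TangentSpace I x) (U W : Set M) (a b : ℝ)
    (γ : ℝ → M → M) : Prop where
  isOpen : IsOpen W
  neg : a < 0
  pos : 0 < b
  zero : ∀ x ∈ W, γ 0 x = x
  mem : ∀ t ∈ Set.Ioo a b, ∀ x ∈ W, γ t x ∈ U
  curve : ∀ x ∈ W, IsMIntegralCurveOn (I := I) (fun t => γ t x) v (Set.Ioo a b)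

namespace System

/-- `v` is an infinitesimal symmetry on the open set `U` of the system: a smooth vector field on
`U` whose local flow maps `γ t` are, for all `t` for which they exist, local symmetries. -/
def IsInfinitesimalSymmetryOn (S : System I M m) (U : Set M) (v : (x : M) → TangentSpace I x) :
    Prop :=
  SmoothFieldOn I v U ∧
    ∀ (W : Set M) (a b : ℝ) (γ : ℝ → M → M), IsLocalFlow v U W a b γ →
      ∀ t ∈ Set.Ioo a b, S.IsLocalSymmetryOn (γ t) W

/-- `𝔞` is an abelian subalgebra of the Lie algebra of infinitesimal symmetries on the open set
`U` of the system: a real vector space of infinitesimal symmetries whose Lie brackets vanish, so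
that it is closed under brackets. (Vector fields on `U` are given by sections over `M`, whose
values outside `U` play no role.) -/
def IsAbelianSymmetryAlgebraOn (S : System I M m) (U : Set M)
    (𝔞 : Submodule ℝ ((x : M) → TangentSpace I x)) : Prop :=
  (∀ v ∈ 𝔞, S.IsInfinitesimalSymmetryOn U v) ∧
    ∀ v ∈ 𝔞, ∀ w ∈ 𝔞, ∀ x ∈ U, VectorField.mlieBracket I v w x = 0

end System

end General

/-- The space `ℝ^p × ℝ^m` of the pairs `(x, w)`. -/
abbrev Model (p m : ℕ) : Type := EuclideanSpace ℝ (Fin p) × EuclideanSpace ℝ (Fin m)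

theorem smoothFieldOn_of_contDiff {p m : ℕ} {V : Model p m → Model p m} (hV : ContDiff ℝ ∞ V) :
    SmoothFieldOn 𝓘(ℝ, Model p m) (M := Model p m) V Set.univ :=
  contMDiffOn_vectorSpace_iff_contDiffOn.2 hV.contDiffOn

/-- The system `x' = h(x, w)`, `w' = u` on `ℝ^p × ℝ^m`. -/
def extendedSystem {p m : ℕ} (h : Model p m → EuclideanSpace ℝ (Fin p)) (hh : ContDiff ℝ ∞ h) :
    System 𝓘(ℝ, Model p m) (Model p m) m where
  f z := ((h z, 0) : Model p m)
  g i _ := ((0, EuclideanSpace.single i 1) : Model p m)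
  smooth_f := smoothFieldOn_of_contDiff (hh.prodMk contDiff_const)
  smooth_g _ := smoothFieldOn_of_contDiff contDiff_const

/-- The trivial system `x' = F(w)`, `w' = u` on `ℝ^p × ℝ^m`. -/
def trivialSystem {p m : ℕ} (F : EuclideanSpace ℝ (Fin m) → EuclideanSpace ℝ (Fin p))
    (hF : ContDiff ℝ ∞ F) : System 𝓘(ℝ, Model p m) (Model p m) m :=
  extendedSystem (fun z => F z.2) (hF.comp contDiff_snd)

/-- `S`, with state in an `n`-dimensional manifold and `m` controls, is locally trivialisable at
`x₀`: it is locally feedback equivalent to a trivial system on `ℝ^(n-m) × ℝ^m`. (If `n < m` there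
is no local diffeomorphism to the model, and no system is locally trivialisable.) -/
def System.LocallyTrivialisable {n m : ℕ} {M : Type*} [TopologicalSpace M]
    [ChartedSpace (EuclideanSpace ℝ (Fin n)) M] [IsManifold (𝓡 n) ∞ M]
    (S : System (𝓡 n) M m) (x₀ : M) : Prop :=
  ∃ (F : EuclideanSpace ℝ (Fin m) → EuclideanSpace ℝ (Fin (n - m))) (hF : ContDiff ℝ ∞ F)
    (z₀ : Model (n - m) m), S.LocallyFeedbackEquivalent x₀ (trivialSystem F hF) z₀

end ControlAffine

end

/-! Feedback only changes a frame of `𝒢` and moves `f` along `𝒢`. Hence feedback equivalence to `x'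
= h(x,w)`, `w' = u` amounts to coordinates in which the `g i` are independent and vertical and the
horizontal part of `f` is `h` (`locallyFeedbackEquivalent_extendedSystem_iff`). There `𝒜` is the set
of velocities with horizontal part `h`, and `[f, g i]` has horizontal part `-∂h/∂w (g i)`, so that
`rk 𝒢¹ = m + rk ∂h/∂w` (`finrank_G1`).

Part (i): if `h = F(w)`, then `dh` and `∂h/∂w` have the same range, so `rk dh = k`. Conversely, let
`rk dh` and `rk ∂h/∂w` both be `k`. Then `k` suitable combinations of the `h_i` can replace `k` of
the coordinates `w`, with `x` untouched. By constancy of the rank `h` is a function of these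
combinations, hence of the new `w` alone (`exists_factorisation`).

Part (ii): for a trivial system the fields constant and horizontal in the coordinates commute, and
their flows are translations in `x`, which preserve `F(w)` and hence `𝒜`
(`IsNormalForm.exists_abelian`). Conversely, commuting symmetries transverse to `𝒢` are straightened
simultaneously to constant horizontal fields (`exists_straightening`). Their flows being
translations, `𝒜` and its direction `𝒢` do not depend on `x`, and `𝒢` is given by `dx = b(w) dw`
(`exists_graph`). Involutivity makes `b` closed, so `b = dB` by the Poincaré lemma, and the shear `x
↦ x - B(w)` makes `𝒢` vertical and the horizontal drift a function of `w`
(`exists_isNormalForm_of_abelian`).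

Straightening needs a joint flow smooth in parameters and initial values. `exists_commuting_flow`
obtains it from the implicit function theorem in the Banach space of continuous curves on `[0, 1]`.
-/

noncomputable section
namespace ControlAffine

/-! ### Smoothness of postcomposition on spaces of continuous maps. -/

section Postcomposition

universe u

variable {K : Type*} [TopologicalSpace K] [CompactSpace K]

/-- Pointwise application of a continuous family of operators to a continuous map. -/
def pointwiseApply (K : Type*) [TopologicalSpace K] [CompactSpace K] (E F : Type*)
    [NormedAddCommGroup E] [NormedSpace ℝ E] [NormedAddCommGroup F] [NormedSpace ℝ F] :
    C(K, E →L[ℝ] F) →L[ℝ] C(K, E) →L[ℝ] C(K, F) :=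
  LinearMap.mkContinuous₂
    (LinearMap.mk₂ ℝ (fun (A : C(K, E →L[ℝ] F)) (u : C(K, E)) =>
        (⟨fun t => A t (u t), A.continuous.clm_apply u.continuous⟩ : C(K, F)))
      (fun A B u => by ext t; simp) (fun c A u => by ext t; simp)
      (fun A u v => by ext t; simp) (fun c A u => by ext t; simp)) 1
    (fun A u => by
      rw [one_mul]
      refine (ContinuousMap.norm_le _ (by positivity)).2 fun t => ?_
      exact (A t).le_of_opNorm_le_of_le (A.norm_coe_le_norm t) (u.norm_coe_le_norm t))

@[simp] theorem pointwiseApply_apply {E F : Type*}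
    [NormedAddCommGroup E] [NormedSpace ℝ E] [NormedAddCommGroup F] [NormedSpace ℝ F]
    (A : C(K, E →L[ℝ] F)) (u : C(K, E)) (t : K) : pointwiseApply K E F A u t = A t (u t) := rfl

variable {E F : Type u} [NormedAddCommGroup E] [NormedSpace ℝ E]
  [NormedAddCommGroup F] [NormedSpace ℝ F]

/-- The derivative is pointwise multiplication by `f'`. The remainder is uniform over `K` because `u
↦ f' ∘ u` is continuous for the sup norm, so no local compactness of `E` is needed. -/
theorem hasFDerivAt_postcomp {f : E → F} (hf : ContDiff ℝ 1 f) (u : C(K, E)) :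
    HasFDerivAt (fun u : C(K, E) => (⟨f, hf.continuous⟩ : C(E, F)).comp u)
      (pointwiseApply K E F
        ((⟨fderiv ℝ f, hf.continuous_fderiv one_ne_zero⟩ : C(E, E →L[ℝ] F)).comp u)) u := by
  rw [hasFDerivAt_iff_isLittleO_nhds_zero, Asymptotics.isLittleO_iff]
  intro ε hε
  set D : C(E, E →L[ℝ] F) := ⟨fderiv ℝ f, hf.continuous_fderiv one_ne_zero⟩
  have hcont : Continuous fun u : C(K, E) => D.comp u := ContinuousMap.continuous_postcomp D
  obtain ⟨δ, hδ, hδ'⟩ := (Metric.continuousAt_iff (f := fun u : C(K, E) => D.comp u) (a := u)).1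
    hcont.continuousAt ε hε
  filter_upwards [Metric.ball_mem_nhds (0 : C(K, E)) hδ] with h hh
  refine (ContinuousMap.norm_le _ (by positivity)).2 fun t => ?_
  -- A point of the segment is the value at `t` of `u + s • h`, which lies in the `δ`-ball about
  -- `u`.
  have key : ∀ y ∈ segment ℝ (u t) (u t + h t), ‖fderiv ℝ f y - D (u t)‖ ≤ ε := by
    intro y hy
    rw [segment_eq_image'] at hy
    obtain ⟨s, hs, rfl⟩ := hy
    have h1 : dist (u + s • h) u < δ := by
      rw [dist_eq_norm, add_sub_cancel_left]
      refine lt_of_le_of_lt ?_ (mem_ball_zero_iff.1 hh)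
      rw [norm_smul, Real.norm_of_nonneg hs.1]
      exact mul_le_of_le_one_left (norm_nonneg _) hs.2
    have h2 := hδ' h1
    have h3 : dist (D.comp (u + s • h) t) (D.comp u t) ≤ ε :=
      (ContinuousMap.dist_apply_le_dist t).trans h2.le
    rw [dist_eq_norm] at h3
    simpa [D] using h3
  have := (convex_segment (u t) (u t + h t)).norm_image_sub_le_of_norm_hasFDerivWithin_le'
    (f := f) (f' := fderiv ℝ f) (φ := D (u t)) (C := ε)
    (fun y _ => (hf.differentiable one_ne_zero y).hasFDerivAt.hasFDerivWithinAt) key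
    (left_mem_segment ℝ _ _) (right_mem_segment ℝ _ _)
  refine (le_trans (le_of_eq ?_) this).trans ?_
  · simp
  · rw [add_sub_cancel_left]
    gcongr
    exact h.norm_coe_le_norm t

/-- Induction on the order: the derivative is a bounded linear map applied to postcomposition with
`f'`. Since `f'` takes values in `E →L[ℝ] F`, the spaces vary in the induction, and a common
universe keeps them in range. -/
theorem contDiff_postcomp_nat (n : ℕ) : ∀ {E F : Type u} [NormedAddCommGroup E] [NormedSpace ℝ E]
    [NormedAddCommGroup F] [NormedSpace ℝ F] (f : C(E, F)), ContDiff ℝ ∞ f →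
    ContDiff ℝ n (fun u : C(K, E) => f.comp u) := by
  induction n with
  | zero =>
    intro E F _ _ _ _ f hf
    exact contDiff_zero.2 (ContinuousMap.continuous_postcomp f)
  | succ n ih =>
    intro E F _ _ _ _ f hf
    have hf1 : ContDiff ℝ 1 f := hf.of_le (by exact_mod_cast le_top)
    rw [Nat.cast_succ, contDiff_succ_iff_fderiv]
    refine ⟨fun u => (hasFDerivAt_postcomp hf1 u).differentiableAt, by simp, ?_⟩
    have : fderiv ℝ (fun u : C(K, E) => f.comp u) = fun u => pointwiseApply K E F
        ((⟨fderiv ℝ f, hf1.continuous_fderiv one_ne_zero⟩ : C(E, E →L[ℝ] F)).comp u) := by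
      ext1 u
      exact (hasFDerivAt_postcomp hf1 u).fderiv
    rw [this]
    exact (pointwiseApply K E F).contDiff.comp
      (ih (E := E) (F := E →L[ℝ] F) ⟨fderiv ℝ f, hf1.continuous_fderiv one_ne_zero⟩
        (hf.fderiv_right (m := ∞) le_rfl))

/-- Postcomposition with a smooth map is smooth on the space of continuous maps. -/
theorem contDiff_postcomp (f : C(E, F)) (hf : ContDiff ℝ ∞ f) :
    ContDiff ℝ ∞ (fun u : C(K, E) => f.comp u) :=
  contDiff_infty.2 fun n => contDiff_postcomp_nat n f hf

end Postcomposition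

/-! ### Integration of curves and uniqueness for linear integral equations. -/

section Primitive

variable {E : Type*} [NormedAddCommGroup E] [NormedSpace ℝ E]

/-- The operator that sends a continuous curve on `[0, 1]` to its primitive vanishing at `0`. -/
def primitive (E : Type*) [NormedAddCommGroup E] [NormedSpace ℝ E] :
    C(Set.Icc (0 : ℝ) 1, E) →L[ℝ] C(Set.Icc (0 : ℝ) 1, E) :=
  LinearMap.mkContinuous
    { toFun := fun u => ⟨fun t => ∫ s in (0 : ℝ)..t, Set.IccExtend zero_le_one u s,
        (intervalIntegral.continuous_primitive
          (fun a b => (u.continuous.Icc_extend' (h := zero_le_one)).intervalIntegrable a b) 0).comp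
          continuous_subtype_val⟩
      map_add' := fun u v => by
        ext t
        exact intervalIntegral.integral_add
          ((u.continuous.Icc_extend' (h := zero_le_one)).intervalIntegrable _ _)
          ((v.continuous.Icc_extend' (h := zero_le_one)).intervalIntegrable _ _)
      map_smul' := fun c u => by
        ext t
        exact intervalIntegral.integral_smul c _ } 1
    (fun u => by
      rw [one_mul]
      refine (ContinuousMap.norm_le _ (by positivity)).2 fun t => ?_
      refine (intervalIntegral.norm_integral_le_of_norm_le_const (C := ‖u‖)
        fun s _ => u.norm_coe_le_norm _).trans ?_
      rw [sub_zero, abs_of_nonneg t.2.1]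
      exact mul_le_of_le_one_right (norm_nonneg _) t.2.2)

theorem primitive_apply (u : C(Set.Icc (0 : ℝ) 1, E)) (t : Set.Icc (0 : ℝ) 1) :
    primitive E u t = ∫ s in (0 : ℝ)..t, Set.IccExtend zero_le_one u s := rfl

theorem hasDerivAt_integral_iccExtend [CompleteSpace E] (u : C(Set.Icc (0 : ℝ) 1, E)) (t : ℝ) :
    HasDerivAt (fun t : ℝ => ∫ s in (0 : ℝ)..t, Set.IccExtend zero_le_one u s)
      (Set.IccExtend zero_le_one u t) t :=
  have hc := u.continuous.Icc_extend' (h := zero_le_one)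
  intervalIntegral.integral_hasDerivAt_right (hc.intervalIntegrable _ _)
    (hc.stronglyMeasurableAtFilter _ _) hc.continuousAt

/-- A continuous curve that is the primitive of its image under a continuous family of operators
vanishes. -/
theorem eq_zero_of_eq_primitive [CompleteSpace E] (A : C(Set.Icc (0 : ℝ) 1, E →L[ℝ] E))
    (r : C(Set.Icc (0 : ℝ) 1, E)) (h : r = primitive E (pointwiseApply _ E E A r)) : r = 0 := by
  set R : ℝ → E := fun t => ∫ s in (0 : ℝ)..t,
    Set.IccExtend zero_le_one (pointwiseApply _ E E A r) s
  have hR : ∀ t : Set.Icc (0 : ℝ) 1, R t = r t := fun t => by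
    conv_rhs => rw [h]
    rfl
  have hd := hasDerivAt_integral_iccExtend (pointwiseApply _ E E A r)
  have h0 : ∀ t ∈ Set.Icc (0 : ℝ) 1, R t = 0 := by
    -- Grönwall's argument: `‖R'‖ ≤ ‖A‖ ‖R‖` and `R 0 = 0`.
    refine eq_zero_of_abs_deriv_le_mul_abs_self_of_eq_zero_right (K := ‖A‖)
      (fun t _ => (hd t).continuousAt.continuousWithinAt)
      (fun t _ => (hd t).hasDerivWithinAt) (by simp [R]) fun t ht => ?_
    have ht' : t ∈ Set.Icc (0 : ℝ) 1 := ⟨ht.1, ht.2.le⟩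
    rw [Set.IccExtend_of_mem _ _ ht', pointwiseApply_apply, show R t = _ from hR ⟨t, ht'⟩]
    exact (A _).le_of_opNorm_le (A.norm_coe_le_norm _) _
  ext t
  rw [← hR t, h0 t t.2]
  rfl

end Primitive

/-- `ContDiffAt` of order `∞` at a point does not pass to a neighbourhood, since the neighbourhood
may shrink with the order. The implicit function theorem is therefore applied again at each nearby
point of the graph, and local uniqueness identifies the two implicit functions. -/
theorem eventually_contDiffAt_implicitFunction {E₁ E₂ F : Type*}
    [NormedAddCommGroup E₁] [NormedSpace ℝ E₁] [CompleteSpace E₁]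
    [NormedAddCommGroup E₂] [NormedSpace ℝ E₂] [CompleteSpace E₂]
    [NormedAddCommGroup F] [NormedSpace ℝ F] [CompleteSpace F] {f : E₁ × E₂ → F}
    (hf : ContDiff ℝ ∞ f) {u : E₁ × E₂} (hu : ContDiffAt ℝ ∞ f u)
    (hinv : (fderiv ℝ f u ∘L .inr ℝ E₁ E₂).IsInvertible) :
    ∀ᶠ x in 𝓝 u.1, ContDiffAt ℝ ∞ (hu.implicitFunction (by simp) hinv) x := by
  set ψ := hu.implicitFunction (by simp) hinv with hψ
  have hψ1 : ∀ᶠ x in 𝓝 u.1, ContDiffAt ℝ 1 ψ x :=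
    ((hu.contDiffAt_implicitFunction (by simp) hinv).of_le (m := 1)
      (by exact_mod_cast le_top)).eventually (by simp)
  have hψu : ψ u.1 = u.2 := hu.implicitFunction_apply_self (by simp) hinv
  have hgc : Filter.Tendsto (fun x => (x, ψ x)) (𝓝 u.1) (𝓝 u) := by
    have h := continuousAt_id.prodMk hψ1.self_of_nhds.continuousAt
    rw [ContinuousAt, hψu] at h
    exact h
  have hinv' : ∀ᶠ v in 𝓝 u, (fderiv ℝ f v ∘L .inr ℝ E₁ E₂).IsInvertible := by
    obtain ⟨e, he⟩ := hinv
    have hc : Continuous fun v => fderiv ℝ f v ∘L .inr ℝ E₁ E₂ :=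
      (hf.continuous_fderiv (by simp)).clm_comp continuous_const
    have hn := e.nhds
    rw [he] at hn
    exact hc.continuousAt hn
  filter_upwards [hψ1, hgc.eventually hinv',
    (hu.eventually_apply_implicitFunction (by simp) hinv).eventually_nhds] with x hx1 hx2 hx3
  have hx4 : ContDiffAt ℝ ∞ f (x, ψ x) := hf.contDiffAt
  refine (hx4.contDiffAt_implicitFunction (by simp) hx2).congr_of_eventuallyEq ?_
  have hgx : Filter.Tendsto (fun y => (y, ψ y)) (𝓝 x) (𝓝 (x, ψ x)) :=
    continuousAt_id.prodMk hx1.continuousAt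
  filter_upwards [hgx.eventually (hx4.eventually_apply_eq_iff_implicitFunction (by simp) hx2), hx3]
    with y hy1 hy2
  exact (hy1.1 (hy2.trans hx3.self_of_nhds.symm)).symm

/-! ### The joint flow of commuting vector fields. -/

section CommutingFlows

universe u

/-- The linear operator that sends a vector to the constant curve on `[0, 1]`. -/
def constCurve (E : Type*) [NormedAddCommGroup E] [NormedSpace ℝ E] :
    E →L[ℝ] C(Set.Icc (0 : ℝ) 1, E) :=
  ContinuousLinearMap.const ℝ _

@[simp] theorem constCurve_apply {E : Type*} [NormedAddCommGroup E] [NormedSpace ℝ E] (z : E)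
    (t : Set.Icc (0 : ℝ) 1) : constCurve E z t = z := rfl

variable {C E : Type u} [NormedAddCommGroup C] [NormedSpace ℝ C]
  [NormedAddCommGroup E] [NormedSpace ℝ E]

/-- The defect of the integral equation `u t = z + ∫ s in 0..t, V (u s) c`. -/
def flowDefect (V : C(E, C →L[ℝ] E)) (q : (C × E) × C(Set.Icc (0 : ℝ) 1, E)) :
    C(Set.Icc (0 : ℝ) 1, E) :=
  q.2 - constCurve E q.1.2 -
    primitive E (pointwiseApply _ C E (V.comp q.2) (constCurve C q.1.1))

theorem contDiff_pointwiseApply :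
    ContDiff ℝ ∞ fun A : C(Set.Icc (0 : ℝ) 1, C →L[ℝ] E) => pointwiseApply _ C E A := by
  fun_prop

theorem contDiff_flowDefect (V : C(E, C →L[ℝ] E)) (hV : ContDiff ℝ ∞ V) :
    ContDiff ℝ ∞ (flowDefect V) := by
  have h := contDiff_postcomp (K := Set.Icc (0 : ℝ) 1) V hV
  refine (contDiff_snd.sub ((constCurve E).contDiff.comp (contDiff_snd.comp contDiff_fst))).sub
    ((primitive E).contDiff.comp ?_)
  have h1 : ContDiff ℝ ∞ fun q : (C × E) × C(Set.Icc (0 : ℝ) 1, E) =>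
      pointwiseApply _ C E (V.comp q.2) :=
    contDiff_pointwiseApply.comp (h.comp contDiff_snd)
  have h2 : ContDiff ℝ ∞ fun q : (C × E) × C(Set.Icc (0 : ℝ) 1, E) => constCurve C q.1.1 :=
    (constCurve C).contDiff.comp (contDiff_fst.comp contDiff_fst)
  exact h1.clm_apply h2

/-- At `c = 0` the integral term vanishes, so the partial derivative in the curve is the identity.
Smallness of `c` thus takes the place of smallness of the time. -/
theorem isInvertible_fderiv_flowDefect (V : C(E, C →L[ℝ] E)) (hV : ContDiff ℝ ∞ V) (z : E) :
    (fderiv ℝ (flowDefect V) ((0, z), constCurve E z) ∘L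
      .inr ℝ (C × E) C(Set.Icc (0 : ℝ) 1, E)).IsInvertible := by
  have h1 : HasFDerivAt (fun u => flowDefect V (((0, z) : C × E), u))
      (fderiv ℝ (flowDefect V) ((0, z), constCurve E z) ∘L
        .inr ℝ (C × E) C(Set.Icc (0 : ℝ) 1, E)) (constCurve E z) :=
    (((contDiff_flowDefect V hV).differentiable (by simp)) _).hasFDerivAt.comp (constCurve E z)
      (hasFDerivAt_prodMk_right (𝕜 := ℝ) ((0, z) : C × E) (constCurve E z))
  have h2 : HasFDerivAt (fun u => flowDefect V (((0, z) : C × E), u))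
      (ContinuousLinearMap.id ℝ _) (constCurve E z) := by
    have : (fun u => flowDefect V (((0, z) : C × E), u)) = fun u => u - constCurve E z := by
      ext1 u
      simp [flowDefect]
    rw [this]
    exact (hasFDerivAt_id _).sub_const _
  rw [h1.unique h2]
  exact ⟨ContinuousLinearEquiv.refl ℝ _, rfl⟩

/-- If `u` is an integral curve of `V c` and the fields `V e` commute with `V c` along it, then
`t • V (u t) e` solves the linearised equation. -/
theorem smul_field_eq_primitive [CompleteSpace E] (V : C(E, C →L[ℝ] E)) (hV : ContDiff ℝ ∞ V)
    (D : C(E, E →L[ℝ] C →L[ℝ] E)) (hD : ∀ x, D x = fderiv ℝ V x)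
    (u : C(Set.Icc (0 : ℝ) 1, E)) (c e : C) (z : E) (hu : flowDefect V ((c, z), u) = 0)
    (hcomm : ∀ t, fderiv ℝ V (u t) (V (u t) c) e = fderiv ℝ V (u t) (V (u t) e) c)
    (q : C(Set.Icc (0 : ℝ) 1, E)) (hq : ∀ t, q t = (t : ℝ) • V (u t) e) :
    q = primitive E (pointwiseApply _ C E (pointwiseApply _ _ _ (D.comp u) q) (constCurve C c) +
      pointwiseApply _ C E (V.comp u) (constCurve C e)) := by
  set ζ := pointwiseApply _ C E (pointwiseApply _ _ _ (D.comp u) q) (constCurve C c) +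
      pointwiseApply _ C E (V.comp u) (constCurve C e) with hζ
  set w := pointwiseApply _ C E (V.comp u) (constCurve C c) with hw
  set U : ℝ → E := fun t => z + ∫ s in (0 : ℝ)..t, Set.IccExtend zero_le_one w s with hU
  have hUd : ∀ t, HasDerivAt U (Set.IccExtend zero_le_one w t) t := fun t =>
    (hasDerivAt_integral_iccExtend w t).const_add z
  have hUu : ∀ t : Set.Icc (0 : ℝ) 1, U t = u t := fun t => by
    have h1 := congrArg (fun v => v t) hu
    simp only [flowDefect, ContinuousMap.sub_apply, constCurve_apply, ContinuousMap.zero_apply,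
      primitive_apply] at h1
    rw [sub_sub, sub_eq_zero] at h1
    exact h1.symm
  -- The derivative of `s • V(U s) e` is `V e + s • DV(V c) e`; commutation turns the last term into
  -- `s • DV(V e) c`, which gives the integrand `ζ`.
  have hg : ∀ s ∈ Set.Icc (0 : ℝ) 1, HasDerivAt (fun s => s • V (U s) e)
      (Set.IccExtend zero_le_one ζ s) s := fun s hs => by
    have hVd : HasFDerivAt V (fderiv ℝ V (U s)) (U s) :=
      (hV.differentiable (by simp) _).hasFDerivAt
    have h1 : HasDerivAt (fun s => V (U s) e)
        (fderiv ℝ V (U s) (Set.IccExtend zero_le_one w s) e) s := by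
      have h3 := (hVd.comp_hasDerivAt s (hUd s)).clm_apply (hasDerivAt_const s e)
      simpa using h3
    have h2 := (hasDerivAt_id s).smul h1
    convert! h2 using 1
    have hus : U s = u ⟨s, hs⟩ := hUu ⟨s, hs⟩
    rw [Set.IccExtend_of_mem _ _ hs, Set.IccExtend_of_mem _ _ hs, hus, hζ, hw]
    simp only [ContinuousMap.add_apply, pointwiseApply_apply, ContinuousMap.comp_apply,
      constCurve_apply, hq, hD, map_smul, smul_apply, id_eq, one_smul]
    rw [hcomm]
  ext t
  rw [primitive_apply, intervalIntegral.integral_eq_sub_of_hasDerivAt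
    (f := fun s => s • V (U s) e)]
  · simp [hq, hUu]
  · intro s hs
    rw [Set.uIcc_of_le t.2.1] at hs
    exact hg s ⟨hs.1, hs.2.trans t.2.2⟩
  · exact (ζ.continuous.Icc_extend' (h := zero_le_one)).intervalIntegrable _ _

/-- Differentiating the integral equation in the direction `e` of the parameter gives a linear
integral equation for the derivative. By `smul_field_eq_primitive` the curve `t • V(u t) e` solves
it too, and the difference vanishes by `eq_zero_of_eq_primitive`. -/
theorem fderiv_flow_eq [CompleteSpace E] (V : C(E, C →L[ℝ] E)) (hV : ContDiff ℝ ∞ V)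
    (U : C × E → C(Set.Icc (0 : ℝ) 1, E)) (p : C × E) (hU : DifferentiableAt ℝ U p)
    (hUp : ∀ᶠ q in 𝓝 p, flowDefect V (q, U q) = 0)
    (hcomm : ∀ t c e, fderiv ℝ V (U p t) (V (U p t) c) e = fderiv ℝ V (U p t) (V (U p t) e) c)
    (e : C) (t : Set.Icc (0 : ℝ) 1) :
    fderiv ℝ U p (e, 0) t = (t : ℝ) • V (U p t) e := by
  have hV1 : ContDiff ℝ 1 V := hV.of_le (by exact_mod_cast le_top)
  obtain ⟨c, z⟩ := p
  set D : C(E, E →L[ℝ] C →L[ℝ] E) := ⟨fderiv ℝ V, hV1.continuous_fderiv one_ne_zero⟩ with hD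
  set u := U (c, z) with hu
  set d := fderiv ℝ U (c, z) (e, 0) with hd
  have hN : HasFDerivAt (fun q => V.comp (U q))
      ((pointwiseApply _ _ _ (D.comp u)).comp (fderiv ℝ U (c, z))) (c, z) :=
    HasFDerivAt.comp (c, z) (hasFDerivAt_postcomp hV1 u) hU.hasFDerivAt
  have hc : HasFDerivAt (fun q : C × E => constCurve C q.1)
      ((constCurve C).comp (.fst ℝ C E)) (c, z) :=
    ((constCurve C).comp (.fst ℝ C E)).hasFDerivAt
  have hz : HasFDerivAt (fun q : C × E => constCurve E q.2)
      ((constCurve E).comp (.snd ℝ C E)) (c, z) :=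
    ((constCurve E).comp (.snd ℝ C E)).hasFDerivAt
  have hA : HasFDerivAt (fun q : C × E => pointwiseApply (Set.Icc (0 : ℝ) 1) C E (V.comp (U q)))
      ((pointwiseApply _ C E).comp ((pointwiseApply _ _ _ (D.comp u)).comp
        (fderiv ℝ U (c, z)))) (c, z) := by
    refine HasFDerivAt.comp (𝕜 := ℝ) (E := C × E) (F := C(Set.Icc (0 : ℝ) 1, C →L[ℝ] E))
      (G := C(Set.Icc (0 : ℝ) 1, C) →L[ℝ] C(Set.Icc (0 : ℝ) 1, E)) (c, z) ?_ hN
    exact ContinuousLinearMap.hasFDerivAt (𝕜 := ℝ) (E := C(Set.Icc (0 : ℝ) 1, C →L[ℝ] E))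
      (F := C(Set.Icc (0 : ℝ) 1, C) →L[ℝ] C(Set.Icc (0 : ℝ) 1, E)) _
  have hP := hA.clm_apply hc
  have hF : HasFDerivAt (fun q => flowDefect V (q, U q)) _ (c, z) :=
    (hU.hasFDerivAt.sub hz).sub ((primitive E).hasFDerivAt.comp (c, z) hP)
  have hF0 : HasFDerivAt (fun q => flowDefect V (q, U q))
      (0 : C × E →L[ℝ] C(Set.Icc (0 : ℝ) 1, E)) (c, z) :=
    (hasFDerivAt_const (0 : C(Set.Icc (0 : ℝ) 1, E)) (c, z)).congr_of_eventuallyEq hUp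
  have hlin := DFunLike.congr_fun (hF.unique hF0) ((e, 0) : C × E)
  have hlin' : d = primitive E
      (pointwiseApply _ C E (pointwiseApply _ _ _ (D.comp u) d) (constCurve C c) +
      pointwiseApply _ C E (V.comp u) (constCurve C e)) := by
    rw [← sub_eq_zero]
    refine Eq.trans ?_ hlin
    simp only [sub_apply, ContinuousLinearMap.comp_apply,
      add_apply, ContinuousLinearMap.flip_apply,
      ContinuousLinearMap.coe_fst', ContinuousLinearMap.coe_snd', map_zero, sub_zero]
    rw [add_comm]
  set q : C(Set.Icc (0 : ℝ) 1, E) := ⟨fun t => (t : ℝ) • V (u t) e, by fun_prop⟩ with hq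
  have hq' := smul_field_eq_primitive V hV D (fun _ => rfl) u c e z hUp.self_of_nhds
    (fun t => hcomm t c e) q fun _ => rfl
  set A : C(Set.Icc (0 : ℝ) 1, E →L[ℝ] E) :=
    ⟨fun t => (D (u t)).flip c, by
      have : Continuous fun t => (ContinuousLinearMap.flipₗᵢ ℝ E C E) (D (u t)) := by fun_prop
      exact this.clm_apply continuous_const⟩ with hA
  have hr : d - q = 0 := by
    refine eq_zero_of_eq_primitive A (d - q) ?_
    conv_lhs => rw [hlin', hq']
    rw [← map_sub]
    congr 1
    ext t
    simp [hA]
    rfl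
  rw [sub_eq_zero.1 hr, hq]
  rfl

/-- **Joint flow of commuting vector fields.** -/
theorem exists_commuting_flow [CompleteSpace C] [CompleteSpace E] {V : E → C →L[ℝ] E}
    (hV : ContDiff ℝ ∞ V) (z₀ : E)
    (hcomm : ∀ᶠ x in 𝓝 z₀, ∀ c e, fderiv ℝ V x (V x c) e = fderiv ℝ V x (V x e) c) :
    ∃ Ψ : C × E → E, (∀ᶠ q in 𝓝 (0, z₀), ContDiffAt ℝ ∞ Ψ q) ∧ (∀ᶠ z in 𝓝 z₀, Ψ (0, z) = z) ∧
      ∀ᶠ q in 𝓝 ((0, z₀) : C × E), ∀ e, fderiv ℝ Ψ q (e, 0) = V (Ψ q) e := by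
  set V' : C(E, C →L[ℝ] E) := ⟨V, hV.continuous⟩
  have hcd : ContDiffAt ℝ ∞ (flowDefect V') ((0, z₀), constCurve E z₀) :=
    (contDiff_flowDefect V' hV).contDiffAt
  have hinv := isInvertible_fderiv_flowDefect V' hV z₀
  have h0 : flowDefect V' ((0, z₀), constCurve E z₀) = 0 := by simp [flowDefect]
  set U := hcd.implicitFunction (by simp) hinv with hUdef
  have hUs : ContDiffAt ℝ ∞ U (0, z₀) := hcd.contDiffAt_implicitFunction (by simp) hinv
  have hU0 : U (0, z₀) = constCurve E z₀ := hcd.implicitFunction_apply_self (by simp) hinv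
  have hUe : ∀ᶠ q in 𝓝 ((0, z₀) : C × E), flowDefect V' (q, U q) = 0 := by
    have := hcd.eventually_apply_implicitFunction (by simp) hinv
    rwa [h0] at this
  -- `Ψ (c, z)` is the end point at time one of the integral curve of `V c` from `z`.
  set ev : C(Set.Icc (0 : ℝ) 1, E) →L[ℝ] E := ContinuousMap.evalCLM ℝ ⟨1, by simp⟩ with hev
  refine ⟨fun q => ev (U q), ?_, ?_, ?_⟩
  · filter_upwards [eventually_contDiffAt_implicitFunction (contDiff_flowDefect V' hV) hcd hinv]
      with q hq using ev.contDiff.contDiffAt.comp _ hq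
  · have ht : Filter.Tendsto (fun z : E => ((0, z) : C × E)) (𝓝 z₀) (𝓝 (0, z₀)) :=
      (Continuous.prodMk_right (0 : C)).continuousAt
    filter_upwards [ht.eventually hUe] with z hz
    simp only [flowDefect, map_zero, sub_zero, sub_eq_zero] at hz
    rw [hz]
    rfl
  -- Commutation holds only near `z₀`. Sup-norm closeness of `U q` to the constant curve at `z₀`
  -- keeps the entire curve in that region.
  · obtain ⟨ε, hε, hO⟩ := Metric.eventually_nhds_iff.1 hcomm
    have hnear : ∀ᶠ q in 𝓝 ((0, z₀) : C × E), dist (U q) (U (0, z₀)) < ε :=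
      Metric.tendsto_nhds.1 hUs.continuousAt ε hε
    have hd : ∀ᶠ q in 𝓝 ((0, z₀) : C × E), DifferentiableAt ℝ U q := by
      filter_upwards [(hUs.of_le (m := 1) (by exact_mod_cast le_top)).eventually (by simp)]
        with q hq using hq.differentiableAt one_ne_zero
    filter_upwards [hnear, hd, hUe.eventually_nhds] with q hq1 hq2 hq3 e
    have h1 : fderiv ℝ (fun q => ev (U q)) q = ev.comp (fderiv ℝ U q) :=
      (ev.hasFDerivAt.comp q hq2.hasFDerivAt).fderiv
    rw [h1]
    have h2 := fderiv_flow_eq V' hV U q hq2 hq3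
      (fun t c e => hO (lt_of_le_of_lt (by
        have := ContinuousMap.dist_apply_le_dist (f := U q) (g := U (0, z₀)) t
        rwa [hU0] at this ⊢) hq1) c e) e ⟨1, by simp⟩
    rw [one_smul] at h2
    exact h2

end CommutingFlows

/-! ### Partial diffeomorphisms and their differentials. -/

section PartialDiffeomorphisms

variable {E : Type*} [NormedAddCommGroup E] [NormedSpace ℝ E]
  {H : Type*} [TopologicalSpace H] {I : ModelWithCorners ℝ E H}
  {M : Type*} [TopologicalSpace M] [ChartedSpace H M]
  {E' : Type*} [NormedAddCommGroup E'] [NormedSpace ℝ E']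
  {H' : Type*} [TopologicalSpace H'] {I' : ModelWithCorners ℝ E' H'}
  {M' : Type*} [TopologicalSpace M'] [ChartedSpace H' M']
  {E'' : Type*} [NormedAddCommGroup E''] [NormedSpace ℝ E'']
  {H'' : Type*} [TopologicalSpace H''] {I'' : ModelWithCorners ℝ E'' H''}
  {M'' : Type*} [TopologicalSpace M''] [ChartedSpace H'' M'']

/-- The restriction of a partial diffeomorphism to an open set. -/
def restrictOpen (Φ : PartialDiffeomorph I I' M M' ∞) (s : Set M) (hs : IsOpen s) :
    PartialDiffeomorph I I' M M' ∞ where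
  toPartialEquiv := (Φ.toOpenPartialHomeomorph.restrOpen s hs).toPartialEquiv
  open_source := (Φ.toOpenPartialHomeomorph.restrOpen s hs).open_source
  open_target := (Φ.toOpenPartialHomeomorph.restrOpen s hs).open_target
  contMDiffOn_toFun := Φ.contMDiffOn_toFun.mono Set.inter_subset_left
  contMDiffOn_invFun := Φ.contMDiffOn_invFun.mono Set.inter_subset_left

theorem exists_restrict (Φ : PartialDiffeomorph I I' M M' ∞) {P : M → Prop} {x₀ : M}
    (hx₀ : x₀ ∈ Φ.source) (hP : ∀ᶠ x in 𝓝 x₀, P x) :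
    ∃ Ψ : PartialDiffeomorph I I' M M' ∞, x₀ ∈ Ψ.source ∧ Ψ.source ⊆ Φ.source ∧
      (∀ x, Ψ x = Φ x) ∧ (∀ y, Ψ.symm y = Φ.symm y) ∧ ∀ x ∈ Ψ.source, P x := by
  obtain ⟨s, hs, hso, hxs⟩ := eventually_nhds_iff.1 hP
  exact ⟨restrictOpen Φ s hso, ⟨hx₀, hxs⟩, Set.inter_subset_left, fun _ => rfl, fun _ => rfl,
    fun x hx => hs x hx.2⟩

variable (Φ : PartialDiffeomorph I I' M M' ∞)

theorem symm_apply_apply {x : M} (hx : x ∈ Φ.source) : Φ.symm (Φ x) = x := Φ.left_inv hx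

theorem apply_symm_apply {y : M'} (hy : y ∈ Φ.target) : Φ (Φ.symm y) = y := Φ.right_inv hy

theorem apply_mem_target {x : M} (hx : x ∈ Φ.source) : Φ x ∈ Φ.target := Φ.map_source hx

theorem symm_mem_source {y : M'} (hy : y ∈ Φ.target) : Φ.symm y ∈ Φ.source := Φ.map_target hy

theorem contMDiffAt {x : M} (hx : x ∈ Φ.source) : ContMDiffAt I I' ∞ Φ x :=
  Φ.contMDiffOn.contMDiffAt (Φ.open_source.mem_nhds hx)

theorem contMDiffAt_symm {y : M'} (hy : y ∈ Φ.target) : ContMDiffAt I' I ∞ Φ.symm y :=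
  contMDiffAt Φ.symm hy

theorem mfderiv_symm_comp {x : M} (hx : x ∈ Φ.source) :
    (mfderiv I' I Φ.symm (Φ x)).comp (mfderiv I I' Φ x) = ContinuousLinearMap.id ℝ E := by
  have h1 := mfderiv_comp x ((contMDiffAt_symm Φ (apply_mem_target Φ hx)).mdifferentiableAt
    (by simp)) ((contMDiffAt Φ hx).mdifferentiableAt (by simp))
  have h2 : (Φ.symm ∘ Φ) =ᶠ[𝓝 x] id := by
    filter_upwards [Φ.open_source.mem_nhds hx] with y hy using symm_apply_apply Φ hy
  rw [h2.mfderiv_eq, mfderiv_id] at h1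
  exact h1.symm

theorem mfderiv_comp_symm {x : M} (hx : x ∈ Φ.source) :
    (mfderiv I I' Φ x).comp (mfderiv I' I Φ.symm (Φ x)) = ContinuousLinearMap.id ℝ E' := by
  have h := mfderiv_symm_comp Φ.symm (apply_mem_target Φ hx)
  have hx' := symm_apply_apply Φ hx
  rw [hx'] at h
  exact h

/-- The differential of a partial diffeomorphism at a point of its source. -/
def tangentEquiv {x : M} (hx : x ∈ Φ.source) : TangentSpace I x ≃L[ℝ] TangentSpace I' (Φ x) :=
  ContinuousLinearEquiv.equivOfInverse (mfderiv I I' Φ x)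
    (mfderiv I' I Φ.symm (Φ x) : E' →L[ℝ] E)
    (fun v => DFunLike.congr_fun (mfderiv_symm_comp Φ hx) v)
    (fun v => DFunLike.congr_fun (mfderiv_comp_symm Φ hx) v)

theorem mfderiv_injective {x : M} (hx : x ∈ Φ.source) :
    Function.Injective (mfderiv I I' Φ x) := (tangentEquiv Φ hx).injective

theorem mfderiv_surjective {x : M} (hx : x ∈ Φ.source) :
    Function.Surjective (mfderiv I I' Φ x) := (tangentEquiv Φ hx).surjective

theorem mfderiv_trans_apply (Ψ : PartialDiffeomorph I' I'' M' M'' ∞) {x : M} (hx : x ∈ Φ.source)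
    (hx' : Φ x ∈ Ψ.source) (v : TangentSpace I x) :
    mfderiv I I'' (Φ.trans Ψ) x v = mfderiv I' I'' Ψ (Φ x) (mfderiv I I' Φ x v) := by
  have h := mfderiv_comp x ((contMDiffAt Ψ hx').mdifferentiableAt (by simp))
    ((contMDiffAt Φ hx).mdifferentiableAt (by simp))
  exact DFunLike.congr_fun h v

theorem tendsto_symm {x : M} (hx : x ∈ Φ.source) :
    Filter.Tendsto Φ.symm (𝓝 (Φ x)) (𝓝 x) := by
  have h := (contMDiffAt_symm Φ (apply_mem_target Φ hx)).continuousAt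
  rwa [ContinuousAt, symm_apply_apply Φ hx] at h

/-- The chart at a point of a manifold without boundary modelled on itself. -/
def chartDiffeomorph {E : Type*} [NormedAddCommGroup E] [NormedSpace ℝ E] {M : Type*}
    [TopologicalSpace M] [ChartedSpace E M] [IsManifold 𝓘(ℝ, E) ∞ M] (x : M) :
    PartialDiffeomorph 𝓘(ℝ, E) 𝓘(ℝ, E) M E ∞ where
  toPartialEquiv := (chartAt E x).toPartialEquiv
  open_source := (chartAt E x).open_source
  open_target := (chartAt E x).open_target
  contMDiffOn_toFun := contMDiffOn_chart
  contMDiffOn_invFun := contMDiffOn_chart_symm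

end PartialDiffeomorphisms

/-! ### The inverse function theorem. -/

section InverseFunction

variable {E F : Type*} [NormedAddCommGroup E] [NormedSpace ℝ E] [CompleteSpace E]
  [NormedAddCommGroup F] [NormedSpace ℝ F]

/-- **Inverse function theorem** in terms of partial diffeomorphisms. -/
theorem exists_partialDiffeomorph {f : E → F} {a : E} (hf : ∀ᶠ x in 𝓝 a, ContDiffAt ℝ ∞ f x)
    (f' : E ≃L[ℝ] F) (hf' : HasFDerivAt f (f' : E →L[ℝ] F) a) :
    ∃ Φ : PartialDiffeomorph 𝓘(ℝ, E) 𝓘(ℝ, F) E F ∞, a ∈ Φ.source ∧ (∀ x, Φ x = f x) := by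
  have hfa := hf.self_of_nhds
  set e := hfa.toOpenPartialHomeomorph f hf' (by simp) with he
  have hef : ∀ x, e x = f x := fun x => by
    rw [he, ContDiffAt.toOpenPartialHomeomorph_coe]
  have hcont : ContinuousAt (fderiv ℝ f) a := hfa.continuousAt_fderiv (by simp)
  -- Invertible operators form an open set. Restriction to points with invertible derivative makes
  -- the inverse smooth at every point of the target, not only at `f a`.
  have hinv : ∀ᶠ x in 𝓝 a, fderiv ℝ f x ∈
      Set.range (fun e : E ≃L[ℝ] F => (e : E →L[ℝ] F)) := by
    refine hcont ?_
    rw [hf'.fderiv]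
    exact f'.nhds
  obtain ⟨s, hs, hso, has⟩ := eventually_nhds_iff.1 (hf.and hinv)
  set e' := e.restrOpen s hso with he'
  refine ⟨⟨e'.toPartialEquiv, e'.open_source, e'.open_target, ?_, ?_⟩,
    ⟨hfa.mem_toOpenPartialHomeomorph_source hf' (by simp), has⟩, hef⟩
  · intro x hx
    have h : ContMDiffAt 𝓘(ℝ, E) 𝓘(ℝ, F) ∞ f x := ((hs x hx.2).1).contMDiffAt
    exact (h.congr_of_eventuallyEq (Filter.Eventually.of_forall hef)).contMDiffWithinAt
  · intro y hy
    have hx : e'.symm y ∈ s := (e'.map_target hy).2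
    obtain ⟨h1, g, hg⟩ := hs _ hx
    have hee : ⇑e' = f := funext hef
    have h2 : HasFDerivAt e' (g : E →L[ℝ] F) (e'.symm y) := by
      rw [hee, show (g : E →L[ℝ] F) = _ from hg]
      exact (h1.differentiableAt (by simp)).hasFDerivAt
    exact (e'.contDiffAt_symm hy h2 (by rw [hee]; exact h1)).contMDiffAt.contMDiffWithinAt

end InverseFunction

/-! ### Push-forward of vector fields and of their brackets. -/

section PushForward

variable {E : Type*} [NormedAddCommGroup E] [NormedSpace ℝ E]
  {H : Type*} [TopologicalSpace H] {I : ModelWithCorners ℝ E H}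
  {M : Type*} [TopologicalSpace M] [ChartedSpace H M]
  {F : Type*} [NormedAddCommGroup F] [NormedSpace ℝ F]
  (Φ : PartialDiffeomorph I 𝓘(ℝ, F) M F ∞)

/-- The push-forward of a vector field by a partial diffeomorphism to a normed space. -/
def pushField (v : (x : M) → TangentSpace I x) (z : F) : F :=
  mfderiv I 𝓘(ℝ, F) Φ (Φ.symm z) (v (Φ.symm z))

theorem pushField_apply (v : (x : M) → TangentSpace I x) {x : M} (hx : x ∈ Φ.source) :
    pushField Φ v (Φ x) = mfderiv I 𝓘(ℝ, F) Φ x (v x) :=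
  congrArg (fun y => (mfderiv I 𝓘(ℝ, F) Φ y (v y) : F)) (symm_apply_apply Φ hx)

/-- Pushing forward by `Φ` is pulling back by `Φ.symm`; in this form smoothness and naturality of
the bracket follow from the results on `mpullback`. -/
theorem pushField_apply' (v : (x : M) → TangentSpace I x) {z : F} (hz : z ∈ Φ.target) :
    pushField Φ v z = VectorField.mpullback 𝓘(ℝ, F) I Φ.symm v z := by
  have hx := symm_mem_source Φ hz
  have h1 := mfderiv_symm_comp Φ hx
  have h2 := mfderiv_comp_symm Φ hx
  rw [apply_symm_apply Φ hz] at h1 h2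
  rw [VectorField.mpullback_apply]
  exact (DFunLike.congr_fun (ContinuousLinearMap.inverse_eq h1 h2) (v (Φ.symm z))).symm

theorem isInvertible_mfderiv_symm {z : F} (hz : z ∈ Φ.target) :
    (mfderiv 𝓘(ℝ, F) I Φ.symm z).IsInvertible :=
  ⟨tangentEquiv Φ.symm hz, rfl⟩

theorem contDiffAt_pushField [IsManifold I ∞ M] [CompleteSpace F]
    {v : (x : M) → TangentSpace I x} {U : Set M}
    (hv : SmoothFieldOn I v U) (hU : IsOpen U) {x : M} (hx : x ∈ Φ.source) (hxU : x ∈ U) :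
    ContDiffAt ℝ ∞ (pushField Φ v) (Φ x) := by
  have hI : IsManifold I 1 M := IsManifold.of_le (n := ∞) (by exact_mod_cast le_top)
  have hx' := apply_mem_target Φ hx
  have h1 : ContMDiffAt I I.tangent ∞ (fun x => (⟨x, v x⟩ : TangentBundle I M))
      (Φ.symm (Φ x)) := by
    rw [symm_apply_apply Φ hx]
    exact hv.contMDiffAt (hU.mem_nhds hxU)
  have h2 := h1.mpullback_vectorField_preimage (contMDiffAt_symm Φ hx')
    (isInvertible_mfderiv_symm Φ hx') (m := ∞) (by simp)
  rw [contMDiffAt_vectorSpace_iff_contDiffAt] at h2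
  refine h2.congr_of_eventuallyEq ?_
  filter_upwards [Φ.open_target.mem_nhds hx'] with z hz using pushField_apply' Φ v hz

theorem mlieBracket_eq_lieBracket (V W : F → F) (x : F) :
    VectorField.mlieBracket 𝓘(ℝ, F) V W x = VectorField.lieBracket ℝ V W x := by
  have h := VectorField.mlieBracketWithin_eq_lieBracketWithin (𝕜 := ℝ) (V := V) (W := W)
    (s := Set.univ)
  have h1 := VectorField.mlieBracketWithin_univ (I := 𝓘(ℝ, F)) (V := V) (W := W)
  exact (congrFun h1 x).symm.trans ((congrFun h x).trans
    (congrFun VectorField.lieBracketWithin_univ x))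

theorem two_le_infty : (2 : WithTop ℕ∞) ≤ ∞ := WithTop.coe_le_coe.2 (le_top (a := (2 : ℕ∞)))

/-- This is naturality of the bracket under pullback by `Φ.symm`. It moves bracket computations to
the normed space `F`. -/
theorem mfderiv_mlieBracket [IsManifold I ∞ M] [CompleteSpace F]
    {v w : (x : M) → TangentSpace I x} {U : Set M}
    (hv : SmoothFieldOn I v U) (hw : SmoothFieldOn I w U) (hU : IsOpen U) {x : M}
    (hx : x ∈ Φ.source) (hxU : x ∈ U) :
    mfderiv I 𝓘(ℝ, F) Φ x (VectorField.mlieBracket I v w x) =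
      VectorField.lieBracket ℝ (pushField Φ v) (pushField Φ w) (Φ x) := by
  have hI : IsManifold I (minSmoothness ℝ 2) M :=
    IsManifold.of_le (n := ∞)
      (by simp only [minSmoothness_of_isRCLikeNormedField]; exact two_le_infty)
  have hx' := apply_mem_target Φ hx
  have h1 (u : (x : M) → TangentSpace I x) (hu : SmoothFieldOn I u U) :
      MDifferentiableAt I I.tangent (fun x => (⟨x, u x⟩ : TangentBundle I M)) (Φ.symm (Φ x)) := by
    rw [symm_apply_apply Φ hx]
    exact (hu.contMDiffAt (hU.mem_nhds hxU)).mdifferentiableAt (by simp)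
  have h2 := VectorField.mpullback_mlieBracket (h1 v hv) (h1 w hw) (contMDiffAt_symm Φ hx')
    (by simp only [minSmoothness_of_isRCLikeNormedField]; exact two_le_infty)
  have h3 (u : (x : M) → TangentSpace I x) :
      VectorField.mpullback 𝓘(ℝ, F) I Φ.symm u =ᶠ[𝓝 (Φ x)] pushField Φ u := by
    filter_upwards [Φ.open_target.mem_nhds hx'] with z hz using (pushField_apply' Φ u hz).symm
  rw [(h3 v).mlieBracket_vectorField_eq (h3 w), ← pushField_apply' Φ _ hx',
    pushField_apply Φ _ hx] at h2
  exact h2.trans (mlieBracket_eq_lieBracket _ _ _)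

end PushForward

/-! ### Globalisation of local smooth functions and the Poincaré lemma. -/

section Local

variable {E F : Type*} [NormedAddCommGroup E] [NormedSpace ℝ E] [FiniteDimensional ℝ E]
  [NormedAddCommGroup F] [NormedSpace ℝ F]

/-- A locally smooth function agrees near the given point with a globally smooth one. -/
theorem exists_contDiff_eventuallyEq {f : E → F} {a : E} (hf : ∀ᶠ x in 𝓝 a, ContDiffAt ℝ ∞ f x) :
    ∃ g : E → F, ContDiff ℝ ∞ g ∧ g =ᶠ[𝓝 a] f := by
  obtain ⟨ε, hε, hs⟩ := Metric.eventually_nhds_iff_ball.1 hf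
  let χ : ContDiffBump a := ⟨ε / 4, ε / 2, by positivity, by linarith⟩
  refine ⟨fun x => χ x • f x, contDiff_iff_contDiffAt.2 fun x => ?_, ?_⟩
  · by_cases hx : x ∈ Metric.ball a ε
    · exact χ.contDiff.contDiffAt.smul (hs x hx)
    · have : x ∉ tsupport χ := by
        rw [χ.tsupport_eq]
        intro h
        exact hx (Metric.closedBall_subset_ball (by show ε / 2 < ε; linarith) h)
      refine contDiffAt_const (c := (0 : F)).congr_of_eventuallyEq ?_
      filter_upwards [(isClosed_tsupport χ).isOpen_compl.mem_nhds this] with y hy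
      rw [image_eq_zero_of_notMem_tsupport hy, zero_smul]
  · filter_upwards [χ.eventuallyEq_one] with x hx
    rw [hx]
    exact one_smul _ _

/-- **Poincaré lemma** for smooth `1`-forms, local version. -/
theorem exists_primitive [CompleteSpace F] {θ : E → E →L[ℝ] F} {a : E}
    (hθ : ∀ᶠ x in 𝓝 a, ContDiffAt ℝ ∞ θ x)
    (hsymm : ∀ᶠ x in 𝓝 a, ∀ u v, fderiv ℝ θ x u v = fderiv ℝ θ x v u) :
    ∃ B : E → F, ContDiff ℝ ∞ B ∧ ∀ᶠ x in 𝓝 a, fderiv ℝ B x = θ x := by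
  obtain ⟨ε, hε, hs⟩ := Metric.eventually_nhds_iff_ball.1 (hθ.and hsymm)
  obtain ⟨f, hf⟩ := (convex_ball a ε).exists_forall_hasFDerivAt_of_fderiv_symmetric
    Metric.isOpen_ball
    (fun x hx => ((hs x hx).1.differentiableAt (by simp)).differentiableWithinAt)
    (fun x hx => (hs x hx).2)
  have hfs : ContDiffOn ℝ ∞ f (Metric.ball a ε) := by
    rw [contDiffOn_infty_iff_fderiv_of_isOpen Metric.isOpen_ball]
    refine ⟨fun x hx => (hf x hx).differentiableAt.differentiableWithinAt, fun x hx => ?_⟩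
    refine ((hs x hx).1.contDiffWithinAt).congr (fun y hy => (hf y hy).fderiv) (hf x hx).fderiv
  obtain ⟨B, hB, hBf⟩ := exists_contDiff_eventuallyEq (f := f) (a := a) (by
    filter_upwards [Metric.ball_mem_nhds a hε] with x hx
      using hfs.contDiffAt (Metric.isOpen_ball.mem_nhds hx))
  refine ⟨B, hB, ?_⟩
  filter_upwards [hBf.eventually_nhds, Metric.ball_mem_nhds a hε] with x hx hx'
  rw [Filter.EventuallyEq.fderiv_eq hx, (hf x hx').fderiv]

end Local

/-! ### Normal forms: `𝒢`, `𝒜` and `𝒢¹` in adapted coordinates. -/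

section NormalForm

variable {E : Type*} [NormedAddCommGroup E] [NormedSpace ℝ E]
  {H : Type*} [TopologicalSpace H] {I : ModelWithCorners ℝ E H}
  {M : Type*} [TopologicalSpace M] [ChartedSpace H M]
  {F : Type*} [NormedAddCommGroup F] [NormedSpace ℝ F] {p m : ℕ}

/-- The differential of a partial diffeomorphism to a normed space, with values in that space. -/
def differentialAt (φ : PartialDiffeomorph I 𝓘(ℝ, F) M F ∞) (x : M) : TangentSpace I x →L[ℝ] F :=
  mfderiv I 𝓘(ℝ, F) φ x

theorem differentialAt_injective (φ : PartialDiffeomorph I 𝓘(ℝ, F) M F ∞) {x : M}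
    (hx : x ∈ φ.source) : Function.Injective (differentialAt φ x) := mfderiv_injective φ hx

theorem differentialAt_surjective (φ : PartialDiffeomorph I 𝓘(ℝ, F) M F ∞) {x : M}
    (hx : x ∈ φ.source) : Function.Surjective (differentialAt φ x) := mfderiv_surjective φ hx

theorem pushField_eq_differentialAt (φ : PartialDiffeomorph I 𝓘(ℝ, F) M F ∞)
    (v : (x : M) → TangentSpace I x) {x : M} (hx : x ∈ φ.source) :
    pushField φ v (φ x) = differentialAt φ x (v x) := pushField_apply φ v hx

theorem differentialAt_trans {F' : Type*} [NormedAddCommGroup F'] [NormedSpace ℝ F']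
    (φ : PartialDiffeomorph I 𝓘(ℝ, F) M F ∞) (Φ : PartialDiffeomorph 𝓘(ℝ, F) 𝓘(ℝ, F') F F' ∞)
    {x : M} (hx : x ∈ φ.source) (hx' : φ x ∈ Φ.source) (v : TangentSpace I x) :
    differentialAt (φ.trans Φ) x v = fderiv ℝ Φ (φ x) (differentialAt φ x v) := by
  have h := mfderiv_trans_apply φ Φ hx hx' v
  rw [mfderiv_eq_fderiv] at h
  exact h

variable [IsManifold I ∞ M]

/-- In the coordinates `φ` the controlled fields span the vertical directions of `ℝ^p × ℝ^m`, and
`x' = h (x, w)`. -/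
structure IsNormalForm (S : System I M m) (h : Model p m → EuclideanSpace ℝ (Fin p))
    (φ : PartialDiffeomorph I 𝓘(ℝ, Model p m) M (Model p m) ∞) : Prop where
  linearIndependent : ∀ x ∈ φ.source, LinearIndependent ℝ fun i => S.g i x
  fst_g : ∀ x ∈ φ.source, ∀ i, (differentialAt φ x (S.g i x)).1 = 0
  fst_f : ∀ x ∈ φ.source, (differentialAt φ x (S.f x)).1 = h (φ x)

theorem eq_sum_inv_of_eq_sum {V : Type*} [AddCommGroup V] [Module ℝ V] {X Y : Fin m → V}
    (β : GL (Fin m) ℝ) (h : ∀ i, Y i = ∑ j, β.val i j • X j) (j : Fin m) :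
    X j = ∑ i, (β⁻¹).val j i • Y i := by
  simp_rw [h, Finset.smul_sum, smul_smul]
  rw [Finset.sum_comm]
  simp_rw [← Finset.sum_smul]
  have hb : (β⁻¹).val * β.val = 1 := by rw [← Units.val_mul, inv_mul_cancel, Units.val_one]
  have (k : Fin m) : ∑ i, (β⁻¹).val j i * β.val i k = if j = k then 1 else 0 := by
    rw [← Matrix.mul_apply, hb, Matrix.one_apply]
  simp only [this, ite_smul, one_smul, zero_smul]
  simp

/-- Dimension count: the span of `Y` has dimension `m` and lies in the span of the `m` vectors `X`.
-/
theorem linearIndependent_of_eq_sum {V : Type*} [AddCommGroup V] [Module ℝ V] {X Y : Fin m → V}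
    (β : Matrix (Fin m) (Fin m) ℝ) (h : ∀ i, Y i = ∑ j, β i j • X j)
    (hY : LinearIndependent ℝ Y) : LinearIndependent ℝ X := by
  rw [linearIndependent_iff_card_le_finrank_span]
  rw [linearIndependent_iff_card_le_finrank_span] at hY
  refine hY.trans ?_
  have : FiniteDimensional ℝ (Submodule.span ℝ (Set.range X)) :=
    FiniteDimensional.span_of_finite ℝ (Set.finite_range X)
  refine Submodule.finrank_mono (Submodule.span_le.2 ?_)
  rintro _ ⟨i, rfl⟩
  rw [h]
  exact Submodule.sum_mem _ fun j _ => Submodule.smul_mem _ _ (Submodule.subset_span ⟨j, rfl⟩)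

theorem linearIndependent_verticalBasis : LinearIndependent ℝ
    fun i : Fin m => ((0, EuclideanSpace.single i 1) : Model p m) := by
  rw [Fintype.linearIndependent_iff]
  intro a ha i
  have h1 := congrArg (fun v : Model p m => v.2 i) ha
  simpa [Prod.snd_sum, Finset.sum_apply, Pi.single_apply] using h1

namespace IsNormalForm

variable {S : System I M m} {h : Model p m → EuclideanSpace ℝ (Fin p)}
  {φ : PartialDiffeomorph I 𝓘(ℝ, Model p m) M (Model p m) ∞}

theorem linearIndependent_differential (hφ : IsNormalForm S h φ) {x : M} (hx : x ∈ φ.source) :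
    LinearIndependent ℝ fun i => differentialAt φ x (S.g i x) :=
  (hφ.linearIndependent x hx).map' (differentialAt φ x).toLinearMap
    (LinearMap.ker_eq_bot.2 (differentialAt_injective φ hx))

theorem linearIndependent_snd (hφ : IsNormalForm S h φ) {x : M} (hx : x ∈ φ.source) :
    LinearIndependent ℝ fun i => (differentialAt φ x (S.g i x)).2 := by
  have h1 := hφ.linearIndependent_differential hx
  rw [Fintype.linearIndependent_iff] at h1 ⊢
  intro a ha i
  refine h1 a (Prod.ext ?_ ?_) i
  · simp [Prod.fst_sum, hφ.fst_g x hx]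
  · simpa [Prod.snd_sum] using ha

theorem exists_eq_sum_snd (hφ : IsNormalForm S h φ) {x : M} (hx : x ∈ φ.source)
    (w : EuclideanSpace ℝ (Fin m)) : ∃ a : Fin m → ℝ,
      ∑ i, a i • (differentialAt φ x (S.g i x)).2 = w := by
  have h1 := (hφ.linearIndependent_snd hx).span_eq_top_of_card_eq_finrank' (by simp)
  have h2 : w ∈ Submodule.span ℝ (Set.range fun i => (differentialAt φ x (S.g i x)).2) := by
    rw [h1]
    trivial
  exact (Submodule.mem_span_range_iff_exists_fun ℝ).1 h2

theorem mem_G_iff (hφ : IsNormalForm S h φ) {x : M} (hx : x ∈ φ.source) (v : TangentSpace I x) :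
    v ∈ S.G x ↔ (differentialAt φ x v).1 = 0 := by
  rw [System.G, Submodule.mem_span_range_iff_exists_fun]
  constructor
  · rintro ⟨a, rfl⟩
    simp [Prod.fst_sum, hφ.fst_g x hx]
  · intro hv
    obtain ⟨a, ha⟩ := hφ.exists_eq_sum_snd hx (differentialAt φ x v).2
    refine ⟨a, differentialAt_injective φ hx (Prod.ext ?_ ?_)⟩
    · simp [Prod.fst_sum, hφ.fst_g x hx, hv]
    · simpa [Prod.snd_sum] using ha

/-- `𝒜` is the translate of `𝒢` by `f`, and `𝒢` is the kernel of the horizontal part of the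
differential. -/
theorem mem_A_iff (hφ : IsNormalForm S h φ) {x : M} (hx : x ∈ φ.source) (v : TangentSpace I x) :
    v ∈ S.A x ↔ (differentialAt φ x v).1 = h (φ x) := by
  have h1 : v ∈ S.A x ↔ v - S.f x ∈ S.G x := by
    rw [System.G, Submodule.mem_span_range_iff_exists_fun]
    exact exists_congr fun a => by rw [eq_sub_iff_add_eq', eq_comm]
  rw [h1, hφ.mem_G_iff hx, map_sub, Prod.fst_sub, hφ.fst_f x hx, sub_eq_zero]

theorem fst_pushField_g (hφ : IsNormalForm S h φ) (i : Fin m) {z : Model p m}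
    (hz : z ∈ φ.target) : (pushField φ (S.g i) z).1 = 0 := by
  have h1 := pushField_eq_differentialAt φ (S.g i) (symm_mem_source φ hz)
  rw [apply_symm_apply φ hz] at h1
  rw [h1, hφ.fst_g _ (symm_mem_source φ hz)]

theorem fst_pushField_f (hφ : IsNormalForm S h φ) {z : Model p m}
    (hz : z ∈ φ.target) : (pushField φ S.f z).1 = h z := by
  have h1 := pushField_eq_differentialAt φ S.f (symm_mem_source φ hz)
  rw [apply_symm_apply φ hz] at h1
  rw [h1, hφ.fst_f _ (symm_mem_source φ hz), apply_symm_apply φ hz]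

end IsNormalForm

theorem finrank_prod_top {V W : Type*} [AddCommGroup V] [Module ℝ V]
    [AddCommGroup W] [Module ℝ W] [FiniteDimensional ℝ V] [FiniteDimensional ℝ W]
    (R : Submodule ℝ V) : Module.finrank ℝ (R.prod (⊤ : Submodule ℝ W)) =
      Module.finrank ℝ R + Module.finrank ℝ W := by
  let e : R.prod (⊤ : Submodule ℝ W) ≃ₗ[ℝ] R × W :=
    { toFun := fun z => (⟨z.1.1, z.2.1⟩, z.1.2)
      invFun := fun z => ⟨(z.1.1, z.2), z.1.2, trivial⟩
      map_add' := fun _ _ => rfl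
      map_smul' := fun _ _ => rfl
      left_inv := fun _ => rfl
      right_inv := fun _ => rfl }
  rw [e.finrank_eq, Module.finrank_prod]

/-- The horizontal component of the bracket with a vertical field. -/
theorem fst_lieBracket {V W : Model p m → Model p m} {k : Model p m → EuclideanSpace ℝ (Fin p)}
    {z : Model p m} (hV : DifferentiableAt ℝ V z) (hW : DifferentiableAt ℝ W z)
    (hVk : ∀ᶠ y in 𝓝 z, (V y).1 = k y) (hW0 : ∀ᶠ y in 𝓝 z, (W y).1 = 0) :
    (VectorField.lieBracket ℝ V W z).1 = -fderiv ℝ k z (W z) := by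
  have h1 : fderiv ℝ k z = (ContinuousLinearMap.fst ℝ _ _).comp (fderiv ℝ V z) := by
    have h : (fun y => (V y).1) =ᶠ[𝓝 z] k := hVk
    rw [← h.fderiv_eq]
    exact ((ContinuousLinearMap.fst ℝ _ _).hasFDerivAt.comp z hV.hasFDerivAt).fderiv
  have h2 : (ContinuousLinearMap.fst ℝ _ _).comp (fderiv ℝ W z) = 0 := by
    have h : (fun y => (W y).1) =ᶠ[𝓝 z] fun _ => 0 := hW0
    have h' := ((ContinuousLinearMap.fst ℝ _ _).hasFDerivAt.comp z hW.hasFDerivAt).fderiv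
    exact h'.symm.trans ((Filter.EventuallyEq.fderiv_eq (𝕜 := ℝ) h).trans (by simp))
  have h3 := DFunLike.congr_fun h2 (V z)
  simp only [ContinuousLinearMap.comp_apply, ContinuousLinearMap.coe_fst', zero_apply] at h3
  -- The bracket is `DW(V) - DV(W)`, and the first term has no horizontal part because `W` is
  -- vertical near `z`.
  rw [VectorField.lieBracket, Prod.fst_sub, h3, h1]
  simp

namespace IsNormalForm

variable {S : System I M m} {h : Model p m → EuclideanSpace ℝ (Fin p)}
  {φ : PartialDiffeomorph I 𝓘(ℝ, Model p m) M (Model p m) ∞}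

theorem fst_bracket (hφ : IsNormalForm S h φ) {x : M} (hx : x ∈ φ.source) (i : Fin m) :
    (differentialAt φ x (VectorField.mlieBracket I S.f (S.g i) x)).1 =
      -fderiv ℝ h (φ x) (differentialAt φ x (S.g i x)) := by
  have h1 := mfderiv_mlieBracket φ S.smooth_f (S.smooth_g i) isOpen_univ hx trivial
  have hz : ∀ᶠ z in 𝓝 (φ x), z ∈ φ.target := φ.open_target.mem_nhds (apply_mem_target φ hx)
  rw [show differentialAt φ x _ = _ from h1, fst_lieBracket (k := h)
    ((contDiffAt_pushField φ S.smooth_f isOpen_univ hx trivial).differentiableAt (by simp))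
    ((contDiffAt_pushField φ (S.smooth_g i) isOpen_univ hx trivial).differentiableAt (by simp))
    (hz.mono fun z hz => hφ.fst_pushField_f hz) (hz.mono fun z hz => hφ.fst_pushField_g i hz),
    pushField_eq_differentialAt φ _ hx]

/-- Modulo `𝒢` the bracket `[f, g i]` is `-∂h/∂w` applied to the `w`-part of `g i`. These parts span
`ℝ^m`, so the brackets fill the range of `∂h/∂w`. -/
theorem mem_G1_iff (hφ : IsNormalForm S h φ) {x : M} (hx : x ∈ φ.source) (v : TangentSpace I x) :
    v ∈ S.G1 x ↔ (differentialAt φ x v).1 ∈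
      LinearMap.range (fderiv ℝ h (φ x) ∘L .inr ℝ _ _).toLinearMap := by
  have hg (i : Fin m) : differentialAt φ x (S.g i x) = (0, (differentialAt φ x (S.g i x)).2) :=
    Prod.ext (hφ.fst_g x hx i) rfl
  constructor
  · intro hv
    let L : TangentSpace I x →ₗ[ℝ] EuclideanSpace ℝ (Fin p) :=
      (ContinuousLinearMap.fst ℝ _ _ ∘L differentialAt φ x).toLinearMap
    suffices S.G1 x ≤ (LinearMap.range
        (fderiv ℝ h (φ x) ∘L .inr ℝ _ _).toLinearMap).comap L from this hv
    refine sup_le (fun w hw => ?_) (Submodule.span_le.2 ?_)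
    · have h0 : L w = 0 := (hφ.mem_G_iff hx w).1 hw
      rw [Submodule.mem_comap, h0]
      exact Submodule.zero_mem _
    · rintro _ ⟨i, rfl⟩
      refine ⟨-(differentialAt φ x (S.g i x)).2, ?_⟩
      refine Eq.trans ?_ (hφ.fst_bracket hx i).symm
      rw [hg i]
      simp only [ContinuousLinearMap.coe_coe, ContinuousLinearMap.comp_apply,
        ContinuousLinearMap.inr_apply]
      rw [← map_neg, Prod.neg_mk, neg_zero]
  · rintro ⟨w, hw⟩
    obtain ⟨a, ha⟩ := hφ.exists_eq_sum_snd hx w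
    -- The brackets are added, not subtracted, because of the sign in `fst_bracket`.
    have h1 : v + ∑ i, a i • VectorField.mlieBracket I S.f (S.g i) x ∈ S.G x := by
      rw [hφ.mem_G_iff hx, map_add, Prod.fst_add, ← hw, map_sum, Prod.fst_sum]
      simp only [map_smul, Prod.smul_fst, hφ.fst_bracket hx]
      rw [← ha]
      simp only [smul_neg, Finset.sum_neg_distrib, ← map_smul, ← map_sum]
      rw [add_neg_eq_zero]
      simp only [ContinuousLinearMap.coe_coe, ContinuousLinearMap.comp_apply,
        ContinuousLinearMap.inr_apply]
      congr 1
      refine Prod.ext ?_ ?_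
      · simp [Prod.fst_sum, hφ.fst_g x hx]
      · simp [Prod.snd_sum]
    have h2 : ∑ i, a i • VectorField.mlieBracket I S.f (S.g i) x ∈ S.G1 x :=
      Submodule.sum_mem _ fun i _ => Submodule.smul_mem _ _
        (Submodule.mem_sup_right (Submodule.subset_span ⟨i, rfl⟩))
    have h3 := Submodule.sub_mem _ (Submodule.mem_sup_left h1 : _ ∈ S.G1 x) h2
    rwa [add_sub_cancel_right] at h3

/-- The differential of `φ` carries `𝒢¹` onto `R × ℝ^m`, where `R` is the range of `∂h/∂w`. -/
theorem finrank_G1 (hφ : IsNormalForm S h φ) {x : M} (hx : x ∈ φ.source) :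
    Module.finrank ℝ (S.G1 x) = m + Module.finrank ℝ
      (LinearMap.range (fderiv ℝ h (φ x) ∘L .inr ℝ _ _).toLinearMap) := by
  set R := LinearMap.range (fderiv ℝ h (φ x) ∘L .inr ℝ _ _).toLinearMap
  let e : TangentSpace I x ≃ₗ[ℝ] Model p m := (tangentEquiv φ hx).toLinearEquiv
  have h1 : (S.G1 x).map e.toLinearMap = R.prod ⊤ := by
    ext z
    rw [Submodule.mem_map]
    constructor
    · rintro ⟨v, hv, rfl⟩
      exact ⟨(hφ.mem_G1_iff hx v).1 hv, trivial⟩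
    · rintro ⟨hz, -⟩
      refine ⟨e.symm z, (hφ.mem_G1_iff hx _).2 ?_, e.apply_symm_apply z⟩
      have : differentialAt φ x (e.symm z) = z := e.apply_symm_apply z
      rwa [this]
  rw [← LinearEquiv.finrank_map_eq e (S.G1 x)]
  erw [h1]
  rw [finrank_prod_top, finrank_euclideanSpace, Fintype.card_fin, add_comm]

end IsNormalForm

end NormalForm

/-! ### Feedback equivalence and normal forms. -/

section Feedback

variable {E : Type*} [NormedAddCommGroup E] [NormedSpace ℝ E]
  {H : Type*} [TopologicalSpace H] {I : ModelWithCorners ℝ E H}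
  {M : Type*} [TopologicalSpace M] [ChartedSpace H M] {p m : ℕ}

theorem contMDiffOn_det {k : ℕ} {s : Set M} {D : M → Matrix (Fin k) (Fin k) ℝ}
    (hD : ∀ i j, ContMDiffOn I 𝓘(ℝ, ℝ) ∞ (fun x => D x i j) s) :
    ContMDiffOn I 𝓘(ℝ, ℝ) ∞ (fun x => (D x).det) s := by
  simp only [Matrix.det_apply']
  refine contMDiffOn_finsetSum fun σ _ => ?_
  exact contMDiffOn_const.mul (contMDiffOn_finsetProd fun i _ => hD _ _)

/-- Cramer's rule: the entries of the adjugate are determinants of `D` with one row replaced by a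
constant one. -/
theorem contMDiffOn_inv {k : ℕ} {s : Set M} {D : M → Matrix (Fin k) (Fin k) ℝ}
    (hD : ∀ i j, ContMDiffOn I 𝓘(ℝ, ℝ) ∞ (fun x => D x i j) s)
    (hdet : ∀ x ∈ s, (D x).det ≠ 0) (i j : Fin k) :
    ContMDiffOn I 𝓘(ℝ, ℝ) ∞ (fun x => (D x)⁻¹ i j) s := by
  have h1 : ContMDiffOn I 𝓘(ℝ, ℝ) ∞ (fun x => ((D x).det)⁻¹) s := by
    intro x hx
    exact ((contDiffAt_inv ℝ (hdet x hx)).contMDiffAt).comp_contMDiffWithinAt x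
      (contMDiffOn_det hD x hx)
  have h2 : ContMDiffOn I 𝓘(ℝ, ℝ) ∞ (fun x => (D x).adjugate i j) s := by
    simp only [Matrix.adjugate_apply]
    refine contMDiffOn_det fun k l => ?_
    by_cases hk : k = j
    · subst hk
      simpa using contMDiffOn_const
    · simpa [Matrix.updateRow_apply, hk] using hD k l
  refine (h1.mul h2).congr fun x _ => ?_
  simp [Matrix.inv_def]

variable [IsManifold I ∞ M]

/-- Inverting `β` writes each `g i` in the vertical basis, so it is vertical, and the feedback `α`
then leaves the horizontal part of `f` unchanged. -/
theorem IsNormalForm.of_feedback {S : System I M m} {h : Model p m → EuclideanSpace ℝ (Fin p)}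
    {hh : ContDiff ℝ ∞ h} {φ : PartialDiffeomorph I 𝓘(ℝ, Model p m) M (Model p m) ∞}
    {α : M → Fin m → ℝ} {β : M → GL (Fin m) ℝ}
    (hφ : ∀ x ∈ φ.source,
      (extendedSystem h hh).f (φ x) = differentialAt φ x (S.f x + ∑ i, α x i • S.g i x) ∧
      ∀ i, (extendedSystem h hh).g i (φ x) =
        differentialAt φ x (∑ j, (β x).val i j • S.g j x)) : IsNormalForm S h φ := by
  have hg (x : M) (hx : x ∈ φ.source) (i : Fin m) :
      ((0, EuclideanSpace.single i 1) : Model p m) =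
        ∑ j, (β x).val i j • differentialAt φ x (S.g j x) := by
    refine ((hφ x hx).2 i).trans ?_
    simp only [map_sum, map_smul]
    rfl
  have hfst (x : M) (hx : x ∈ φ.source) (i : Fin m) : (differentialAt φ x (S.g i x)).1 = 0 := by
    rw [eq_sum_inv_of_eq_sum (β x) (hg x hx) i, Prod.fst_sum]
    simp
  refine ⟨fun x hx => ?_, hfst, fun x hx => ?_⟩
  · have h1 := linearIndependent_of_eq_sum _ (hg x hx) linearIndependent_verticalBasis
    exact LinearIndependent.of_comp (differentialAt φ x).toLinearMap h1
  · have h1 := congrArg Prod.fst (hφ x hx).1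
    rw [map_add, map_sum, Prod.fst_add, Prod.fst_sum] at h1
    simp only [map_smul, Prod.smul_fst, hfst x hx, smul_zero, Finset.sum_const_zero,
      add_zero] at h1
    exact h1.symm

theorem contMDiffOn_coordinate (φ : PartialDiffeomorph I 𝓘(ℝ, Model p m) M (Model p m) ∞)
    {v : (x : M) → TangentSpace I x} (hv : SmoothFieldOn I v Set.univ) (j : Fin m) :
    ContMDiffOn I 𝓘(ℝ, ℝ) ∞ (fun x => (differentialAt φ x (v x)).2 j) φ.source := by
  intro x hx
  have h1 := contDiffAt_pushField φ hv isOpen_univ hx trivial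
  have h2 : ContDiff ℝ ∞ fun z : Model p m => z.2 j := by fun_prop
  have h3 := ((h2.contDiffAt.comp (φ x) h1).contMDiffAt.comp x (contMDiffAt φ hx))
  refine h3.contMDiffWithinAt.congr (fun y hy => ?_) ?_
  · simp only [Function.comp_apply, pushField_eq_differentialAt φ v hy]
  · simp only [Function.comp_apply, pushField_eq_differentialAt φ v hx]

-- The matrix `D` of the `w`-parts of the `g i` is invertible on the source. The feedback `β = D⁻¹`
-- turns the `g i` into the standard vertical basis, and `α = -f_w D⁻¹` cancels the `w`-part `f_w`
-- of the drift.
open Classical in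
theorem IsNormalForm.locallyFeedbackEquivalent {S : System I M m}
    {h : Model p m → EuclideanSpace ℝ (Fin p)} (hh : ContDiff ℝ ∞ h)
    {φ : PartialDiffeomorph I 𝓘(ℝ, Model p m) M (Model p m) ∞} (hφ : IsNormalForm S h φ)
    {x₀ : M} (hx₀ : x₀ ∈ φ.source) :
    S.LocallyFeedbackEquivalent x₀ (extendedSystem h hh) (φ x₀) := by
  set D : M → Matrix (Fin m) (Fin m) ℝ :=
    fun x => Matrix.of fun i j => (differentialAt φ x (S.g i x)).2 j with hD
  have hDs : ∀ i j, ContMDiffOn I 𝓘(ℝ, ℝ) ∞ (fun x => D x i j) φ.source := fun i j =>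
    contMDiffOn_coordinate φ (S.smooth_g i) j
  have hdet : ∀ x ∈ φ.source, (D x).det ≠ 0 := fun x hx h0 => by
    obtain ⟨a, ha, ha0⟩ := Matrix.exists_vecMul_eq_zero_iff.2 h0
    refine ha (funext fun i => ?_)
    refine (Fintype.linearIndependent_iff.1 (hφ.linearIndependent_snd hx)) a ?_ i
    ext j
    have h1 := congrFun ha0 j
    simpa [Matrix.vecMul, dotProduct, hD] using h1
  have hinv : ∀ x ∈ φ.source, (D x)⁻¹ * D x = 1 := fun x hx =>
    Matrix.nonsing_inv_mul _ (isUnit_iff_ne_zero.2 (hdet x hx))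
  have hdet' : ∀ x ∈ φ.source, ((D x)⁻¹).det ≠ 0 := fun x hx h0 => by
    have h1 := congrArg Matrix.det (hinv x hx)
    rw [Matrix.det_mul, h0, zero_mul, Matrix.det_one] at h1
    exact zero_ne_one h1
  set β : M → GL (Fin m) ℝ := fun x => if hx : x ∈ φ.source then
    Matrix.GeneralLinearGroup.mkOfDetNeZero (D x)⁻¹ (hdet' x hx) else 1 with hβ
  have hβv : ∀ x ∈ φ.source, (β x).val = (D x)⁻¹ := fun x hx => by
    simp only [hβ, dif_pos hx]
    rfl
  set α : M → Fin m → ℝ := fun x i =>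
    -∑ k, (differentialAt φ x (S.f x)).2 k * (D x)⁻¹ k i with hα
  have hDsum (x : M) (hx : x ∈ φ.source) (k l : Fin m) :
      ∑ j, (D x)⁻¹ k j * (differentialAt φ x (S.g j x)).2 l = if k = l then 1 else 0 := by
    have h1 := congrFun (congrFun (hinv x hx) k) l
    rwa [Matrix.mul_apply, Matrix.one_apply] at h1
  refine ⟨φ, α, β, hx₀, rfl, fun i => ?_, fun i j => ?_, fun x hx => ⟨?_, fun i => ?_⟩⟩
  · refine (contMDiffOn_finsetSum fun k _ => ?_).neg
    exact (contMDiffOn_coordinate φ S.smooth_f k).mul (contMDiffOn_inv hDs hdet k i)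
  · refine (contMDiffOn_inv hDs hdet i j).congr fun x hx => ?_
    rw [hβv x hx]
  · change ((h (φ x), 0) : Model p m) = differentialAt φ x (S.f x + ∑ i, α x i • S.g i x)
    refine Prod.ext ?_ ?_
    · simp [Prod.fst_sum, hφ.fst_g x hx, hφ.fst_f x hx]
    · ext l
      simp only [map_add, map_sum, map_smul, Prod.snd_add, Prod.snd_sum, Prod.smul_snd,
        PiLp.zero_apply, PiLp.add_apply, WithLp.ofLp_sum, Finset.sum_apply, PiLp.smul_apply,
        smul_eq_mul, hα, neg_mul, Finset.sum_mul, Finset.sum_neg_distrib]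
      rw [Finset.sum_comm]
      simp only [mul_assoc, ← Finset.mul_sum, hDsum x hx]
      simp
  · change ((0, EuclideanSpace.single i 1) : Model p m) =
      differentialAt φ x (∑ j, (β x).val i j • S.g j x)
    rw [hβv x hx]
    refine Prod.ext ?_ ?_
    · simp [Prod.fst_sum, hφ.fst_g x hx]
    · ext l
      simp only [map_sum, map_smul, Prod.snd_sum, Prod.smul_snd,
        WithLp.ofLp_sum, Finset.sum_apply, PiLp.smul_apply, smul_eq_mul, hDsum x hx]
      simp [eq_comm]

theorem locallyFeedbackEquivalent_extendedSystem_iff {S : System I M m}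
    {h : Model p m → EuclideanSpace ℝ (Fin p)} (hh : ContDiff ℝ ∞ h) {x₀ : M} {z₀ : Model p m} :
    S.LocallyFeedbackEquivalent x₀ (extendedSystem h hh) z₀ ↔
      ∃ φ : PartialDiffeomorph I 𝓘(ℝ, Model p m) M (Model p m) ∞,
        x₀ ∈ φ.source ∧ φ x₀ = z₀ ∧ IsNormalForm S h φ := by
  constructor
  · rintro ⟨φ, α, β, hx₀, hz₀, -, -, hφ⟩
    exact ⟨φ, hx₀, hz₀, IsNormalForm.of_feedback (hh := hh) hφ⟩
  · rintro ⟨φ, hx₀, rfl, hφ⟩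
    exact hφ.locallyFeedbackEquivalent hh hx₀

end Feedback

/-! ### The constant rank argument. -/

section ConstantRank

/-- The `dh_i` span the range of the transpose of `dh`, and row rank equals column rank. -/
theorem finrank_span_fderiv_coordinates {V : Type*} [NormedAddCommGroup V] [NormedSpace ℝ V]
    [FiniteDimensional ℝ V] {p : ℕ} {h : V → EuclideanSpace ℝ (Fin p)} {z : V}
    (hh : DifferentiableAt ℝ h z) :
    Module.finrank ℝ (Submodule.span ℝ (Set.range fun i => fderiv ℝ (fun y => h y i) z)) =
      Module.finrank ℝ (LinearMap.range (fderiv ℝ h z).toLinearMap) := by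
  set T : V →ₗ[ℝ] EuclideanSpace ℝ (Fin p) := (fderiv ℝ h z).toLinearMap with hT
  have h1 (i : Fin p) (v : V) : fderiv ℝ (fun y => h y i) z v = T v i := by
    have := (EuclideanSpace.proj i : EuclideanSpace ℝ (Fin p) →L[ℝ] ℝ).hasFDerivAt.comp z
      hh.hasFDerivAt
    exact DFunLike.congr_fun this.fderiv v
  let c : (V →L[ℝ] ℝ) →ₗ[ℝ] Module.Dual ℝ V := ContinuousLinearMap.coeLM ℝ
  have hc : Function.Injective c := ContinuousLinearMap.coe_injective
  rw [← LinearMap.finrank_range_dualMap_eq_finrank_range T,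
    (Submodule.equivMapOfInjective c hc _).finrank_eq]
  refine congrArg (fun R : Submodule ℝ (Module.Dual ℝ V) => Module.finrank ℝ R) ?_
  rw [Submodule.map_span, ← Set.range_comp]
  apply le_antisymm
  · refine Submodule.span_le.2 ?_
    rintro _ ⟨i, rfl⟩
    refine ⟨(EuclideanSpace.proj i : EuclideanSpace ℝ (Fin p) →L[ℝ] ℝ).toLinearMap, ?_⟩
    ext v
    exact (h1 i v).symm
  · rintro _ ⟨f, rfl⟩
    rw [Submodule.mem_span_range_iff_exists_fun]
    refine ⟨fun i => f (EuclideanSpace.single i 1), ?_⟩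
    ext v
    have h2 : T v = ∑ i, T v i • EuclideanSpace.single i (1 : ℝ) := by
      ext j
      simp [WithLp.ofLp_sum, Pi.single_apply]
    rw [LinearMap.dualMap_apply]
    conv_rhs => rw [h2, map_sum]
    rw [LinearMap.sum_apply]
    refine Finset.sum_congr rfl fun i _ => ?_
    rw [map_smul, smul_eq_mul, mul_comm, ← h1]
    rfl

/-- Every linear map between finite-dimensional spaces has a generalised inverse. -/
theorem exists_generalised_inverse {V W : Type*} [AddCommGroup V] [Module ℝ V]
    [AddCommGroup W] [Module ℝ W] (B : V →ₗ[ℝ] W) : ∃ L : W →ₗ[ℝ] V, ∀ v, B (L (B v)) = B v := by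
  obtain ⟨s, hs⟩ := B.rangeRestrict.exists_rightInverse_of_surjective B.range_rangeRestrict
  obtain ⟨L, hL⟩ := LinearMap.exists_extend s
  refine ⟨L, fun v => ?_⟩
  have h1 : L (B v) = s (B.rangeRestrict v) := DFunLike.congr_fun hL (B.rangeRestrict v)
  rw [h1]
  exact congrArg Subtype.val (DFunLike.congr_fun hs (B.rangeRestrict v))

theorem contDiffAt_symm_of_mem {E F : Type*} [NormedAddCommGroup E] [NormedSpace ℝ E]
    [NormedAddCommGroup F] [NormedSpace ℝ F]
    (Φ : PartialDiffeomorph 𝓘(ℝ, E) 𝓘(ℝ, F) E F ∞) {y : F} (hy : y ∈ Φ.target) :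
    ContDiffAt ℝ ∞ Φ.symm y := (contMDiffAt_symm Φ hy).contDiffAt

theorem fderiv_apply_fderiv_symm {E F : Type*} [NormedAddCommGroup E] [NormedSpace ℝ E]
    [NormedAddCommGroup F] [NormedSpace ℝ F]
    (Φ : PartialDiffeomorph 𝓘(ℝ, E) 𝓘(ℝ, F) E F ∞) {y : F} (hy : y ∈ Φ.target) (v : F) :
    fderiv ℝ Φ (Φ.symm y) (fderiv ℝ Φ.symm y v) = v := by
  have h1 := mfderiv_comp_symm Φ (symm_mem_source Φ hy)
  rw [apply_symm_apply Φ hy, mfderiv_eq_fderiv, mfderiv_eq_fderiv] at h1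
  exact DFunLike.congr_fun h1 v

variable {p m : ℕ}

/-- If a linear map `T` becomes, after composition with `L`, of rank at least its own rank, then
`L` is injective on the range of `T`. -/
theorem apply_eq_zero_of_finrank_le {U V W : Type*} [AddCommGroup U] [Module ℝ U]
    [AddCommGroup V] [Module ℝ V] [AddCommGroup W] [Module ℝ W] [FiniteDimensional ℝ U]
    (T : U →ₗ[ℝ] V) (L : V →ₗ[ℝ] W)
    (hr : Module.finrank ℝ (LinearMap.range T) ≤ Module.finrank ℝ (LinearMap.range (L ∘ₗ T)))
    {u : U} (hu : L (T u) = 0) : T u = 0 := by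
  have h1 := T.finrank_range_add_finrank_ker
  have h2 := (L ∘ₗ T).finrank_range_add_finrank_ker
  have h3 : LinearMap.ker T ≤ LinearMap.ker (L ∘ₗ T) := LinearMap.ker_le_ker_comp T L
  have h4 := Submodule.eq_of_le_of_finrank_le h3 (by omega)
  have h5 : u ∈ LinearMap.ker (L ∘ₗ T) := hu
  rw [← h4] at h5
  exact h5

/-- A map `h (x, w)` of constant rank whose restriction to the `w`-directions has the same rank
depends, after a change of the coordinates `w`, on `w` only. -/
theorem exists_factorisation {h : Model p m → EuclideanSpace ℝ (Fin p)} (hh : ContDiff ℝ ∞ h)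
    {z₀ : Model p m} {k : ℕ}
    (hk : ∀ᶠ z in 𝓝 z₀, Module.finrank ℝ (LinearMap.range (fderiv ℝ h z).toLinearMap) = k)
    (hk₀ : Module.finrank ℝ
      (LinearMap.range (fderiv ℝ h z₀ ∘L .inr ℝ _ _).toLinearMap) = k) :
    ∃ (Φ : PartialDiffeomorph 𝓘(ℝ, Model p m) 𝓘(ℝ, Model p m) (Model p m) (Model p m) ∞)
      (F : EuclideanSpace ℝ (Fin m) → EuclideanSpace ℝ (Fin p)), ContDiff ℝ ∞ F ∧
      z₀ ∈ Φ.source ∧ (∀ z v, (fderiv ℝ Φ z v).1 = v.1) ∧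
      ∀ z ∈ Φ.source, h z = F (Φ z).2 := by
  set B := (fderiv ℝ h z₀ ∘L .inr ℝ _ _).toLinearMap with hB
  obtain ⟨L, hL⟩ := exists_generalised_inverse B
  -- `P` is a projection of `ℝ^m` with the kernel of `B`, hence of rank `k`.
  set P : EuclideanSpace ℝ (Fin m) →ₗ[ℝ] EuclideanSpace ℝ (Fin m) := L ∘ₗ B with hP
  have hPP (v) : P (P v) = P v := by simp [hP, hL]
  have hPk : Module.finrank ℝ (LinearMap.range P) = k := by
    have h1 := P.finrank_range_add_finrank_ker
    have h2 := B.finrank_range_add_finrank_ker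
    have h3 : LinearMap.ker P = LinearMap.ker B := by
      ext v
      simp only [LinearMap.mem_ker, hP, LinearMap.comp_apply]
      exact ⟨fun h => by rw [← hL, h, map_zero], fun h => by rw [h, map_zero]⟩
    rw [h3] at h1
    omega
  set L' : EuclideanSpace ℝ (Fin p) →L[ℝ] EuclideanSpace ℝ (Fin m) :=
    LinearMap.toContinuousLinearMap (P ∘ₗ L) with hL'
  set Q : EuclideanSpace ℝ (Fin m) →L[ℝ] EuclideanSpace ℝ (Fin m) :=
    LinearMap.toContinuousLinearMap (LinearMap.id - P) with hQ
  have hL'a (v) : L' v = P (L v) := rfl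
  have hQa (v) : Q v = v - P v := rfl
  -- The `P`-part of `w` is replaced by `L' h`, and the complementary part `Q w` is kept. At `z₀`
  -- the `w`-derivative of the new `w`-component is `P + Q = id`, so `f` is a local diffeomorphism.
  set f : Model p m → Model p m := fun z => (z.1, L' (h z) + Q z.2) with hf
  have hfs : ContDiff ℝ ∞ f :=
    contDiff_fst.prodMk ((L'.contDiff.comp hh).add (Q.contDiff.comp contDiff_snd))
  have hfd (z v : Model p m) : fderiv ℝ f z v = (v.1, L' (fderiv ℝ h z v) + Q v.2) := by
    have h1 : HasFDerivAt f _ z := (hasFDerivAt_fst (𝕜 := ℝ)).prodMk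
      ((L'.hasFDerivAt.comp z (hh.differentiable (by simp) z).hasFDerivAt).add
        (Q.hasFDerivAt.comp z hasFDerivAt_snd))
    rw [h1.fderiv]
    rfl
  have hB0 (b) : fderiv ℝ h z₀ (0, b) = B b := rfl
  have hinj : Function.Injective (fderiv ℝ f z₀) := by
    rw [injective_iff_map_eq_zero]
    rintro ⟨a, b⟩ hab
    rw [hfd, Prod.mk_eq_zero] at hab
    obtain ⟨rfl, hb⟩ := hab
    rw [hB0, hL'a, hQa, show L (B b) = P b from rfl, hPP, add_sub_cancel] at hb
    exact Prod.ext rfl hb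
  let e : Model p m ≃L[ℝ] Model p m :=
    (LinearEquiv.ofInjectiveEndo (fderiv ℝ f z₀).toLinearMap hinj).toContinuousLinearEquiv
  obtain ⟨Φ, hz₀, hΦ⟩ := exists_partialDiffeomorph (f := f) (a := z₀)
    (Filter.Eventually.of_forall fun _ => hfs.contDiffAt) e
    (by
      have : (e : Model p m →L[ℝ] Model p m) = fderiv ℝ f z₀ := by ext v <;> rfl
      rw [this]
      exact (hfs.differentiable (by simp) z₀).hasFDerivAt)
  have hΦf : ⇑Φ.toPartialEquiv = f := funext hΦ
  set y₀ := Φ z₀ with hy₀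
  have hker : ∀ᶠ y in 𝓝 y₀, y ∈ Φ.target ∧
      Module.finrank ℝ (LinearMap.range (fderiv ℝ h (Φ.symm y)).toLinearMap) = k :=
    Filter.Eventually.and (Φ.open_target.mem_nhds (apply_mem_target Φ hz₀)) ((tendsto_symm Φ hz₀).eventually hk)
  obtain ⟨r, hr, hball⟩ := Metric.eventually_nhds_iff_ball.1 hker
  set G : Model p m → EuclideanSpace ℝ (Fin p) := fun y => h (Φ.symm y) with hG
  have hGs : ∀ y ∈ Metric.ball y₀ r, ContDiffAt ℝ ∞ G y := fun y hy =>
    hh.contDiffAt.comp y (contDiffAt_symm_of_mem Φ (hball y hy).1)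
  -- In the new coordinates `P L h` equals `P w`. Hence `P L` composed with `T` has rank at least
  -- `k`, the rank of `T`, and `P L` is injective on the range of `T`. The directions `(a, 0)` are
  -- killed by `P L T` after the change of coordinates, so `T` kills them too.
  have hGd : ∀ y ∈ Metric.ball y₀ r, ∀ a, fderiv ℝ G y (a, 0) = 0 := fun y hy a => by
    obtain ⟨hyt, hyk⟩ := hball y hy
    set T := (fderiv ℝ h (Φ.symm y)).toLinearMap with hT
    have h1 : fderiv ℝ G y = (fderiv ℝ h (Φ.symm y)).comp (fderiv ℝ Φ.symm y) :=
      ((hh.differentiable (by simp) _).hasFDerivAt.comp y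
        ((contDiffAt_symm_of_mem Φ hyt).differentiableAt (by simp)).hasFDerivAt).fderiv
    have h2 (v : Model p m) : P (L (T (fderiv ℝ Φ.symm y v))) = P v.2 := by
      have h3 := congrArg Prod.snd (fderiv_apply_fderiv_symm Φ hyt v)
      rw [hΦf, hfd] at h3
      have h4 := congrArg P h3
      rw [map_add, hQa, map_sub, hPP, sub_self, add_zero, hL'a, hPP] at h4
      exact h4
    rw [h1]
    refine apply_eq_zero_of_finrank_le T (P ∘ₗ L) ?_ (h2 (a, 0) |>.trans (map_zero P))
    rw [hyk, ← hPk]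
    refine Submodule.finrank_mono ?_
    rintro _ ⟨w, rfl⟩
    exact ⟨_, h2 (0, w)⟩
  -- The product carries the maximum norm, so the ball is a product of balls and its `x`-slices are
  -- convex.
  have hconst : ∀ y ∈ Metric.ball y₀ r, G y = G (y₀.1, y.2) := fun y hy => by
    have hy' : y ∈ Metric.ball y₀.1 r ×ˢ Metric.ball y₀.2 r := by rwa [ball_prod_same]
    have hmem : ∀ x ∈ Metric.ball y₀.1 r, ((x, y.2) : Model p m) ∈ Metric.ball y₀ r :=
      fun x hx => by
        rw [← ball_prod_same]
        exact ⟨hx, hy'.2⟩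
    have hd : ∀ x ∈ Metric.ball y₀.1 r, HasFDerivAt (fun x => G (x, y.2)) 0 x := fun x hx => by
      have h1 : HasFDerivAt (fun x => G (x, y.2))
          ((fderiv ℝ G (x, y.2)).comp (.inl ℝ _ (EuclideanSpace ℝ (Fin m)))) x :=
        HasFDerivAt.comp (g := G) (f := fun x => (x, y.2)) x
          ((hGs _ (hmem x hx)).differentiableAt (by simp)).hasFDerivAt
          (hasFDerivAt_prodMk_left x y.2)
      convert h1 using 1
      ext1 a
      exact (hGd _ (hmem x hx) a).symm
    exact (convex_ball y₀.1 r).is_const_of_fderivWithin_eq_zero (𝕜 := ℝ)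
      (f := fun x => G (x, y.2))
      (fun x hx => (hd x hx).differentiableAt.differentiableWithinAt)
      (fun x hx => by
        rw [fderivWithin_of_isOpen Metric.isOpen_ball hx, (hd x hx).fderiv])
      hy'.1 (Metric.mem_ball_self hr)
  obtain ⟨F, hF, hFG⟩ := exists_contDiff_eventuallyEq (f := fun w => G (y₀.1, w)) (a := y₀.2) (by
    filter_upwards [Metric.ball_mem_nhds y₀.2 hr] with w hw
    have : ((y₀.1, w) : Model p m) ∈ Metric.ball y₀ r := by
      rw [← ball_prod_same]
      exact ⟨Metric.mem_ball_self hr, hw⟩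
    exact (hGs _ this).comp w (contDiffAt_const.prodMk contDiffAt_id))
  have hfin : ∀ᶠ z in 𝓝 z₀, z ∈ Φ.source → h z = F (Φ z).2 := by
    have h1 : ∀ᶠ y in 𝓝 y₀, y ∈ Metric.ball y₀ r ∧ F y.2 = G (y₀.1, y.2) :=
      Filter.Eventually.and (Metric.ball_mem_nhds y₀ hr)
        ((continuous_snd.continuousAt (x := y₀)).eventually hFG)
    filter_upwards [(contMDiffAt Φ hz₀).continuousAt.eventually h1] with z hz hzs
    rw [hz.2, ← hconst _ hz.1, hG]
    simp only [symm_apply_apply Φ hzs]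
  obtain ⟨Ψ, hΨ0, hΨs, hΨ, -, hΨP⟩ := exists_restrict Φ hz₀ hfin
  refine ⟨Ψ, F, hF, hΨ0, fun z v => ?_, fun z hz => ?_⟩
  · rw [show ⇑Ψ.toPartialEquiv = f from funext fun z => (hΨ z).trans (hΦ z), hfd]
  · rw [hΨ, hΨP z hz (hΨs hz)]

end ConstantRank

/-! ### The first characterisation. -/

section PartOne

variable {E : Type*} [NormedAddCommGroup E] [NormedSpace ℝ E]
  {H : Type*} [TopologicalSpace H] {I : ModelWithCorners ℝ E H}
  {M : Type*} [TopologicalSpace M] [ChartedSpace H M] [IsManifold I ∞ M] {p m : ℕ}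

/-- As `Φ` preserves horizontal parts of tangent vectors, the `g i` stay vertical and the horizontal
drift is only re-expressed in the new coordinates. -/
theorem IsNormalForm.trans {S : System I M m} {h : Model p m → EuclideanSpace ℝ (Fin p)}
    {φ : PartialDiffeomorph I 𝓘(ℝ, Model p m) M (Model p m) ∞} (hφ : IsNormalForm S h φ)
    {Φ : PartialDiffeomorph 𝓘(ℝ, Model p m) 𝓘(ℝ, Model p m) (Model p m) (Model p m) ∞}
    {F : EuclideanSpace ℝ (Fin m) → EuclideanSpace ℝ (Fin p)}
    (hΦ : ∀ z v, (fderiv ℝ Φ z v).1 = v.1) (hF : ∀ z ∈ Φ.source, h z = F (Φ z).2) :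
    IsNormalForm S (fun z => F z.2) (φ.trans Φ) where
  linearIndependent x hx := hφ.linearIndependent x hx.1
  fst_g x hx i := by
    rw [differentialAt_trans φ Φ hx.1 hx.2, hΦ]
    exact hφ.fst_g x hx.1 i
  fst_f x hx := by
    rw [differentialAt_trans φ Φ hx.1 hx.2, hΦ, hφ.fst_f x hx.1]
    exact hF _ hx.2

theorem fderiv_comp_snd_range {F : EuclideanSpace ℝ (Fin m) → EuclideanSpace ℝ (Fin p)}
    (hF : ContDiff ℝ ∞ F) (z : Model p m) :
    LinearMap.range (fderiv ℝ (fun z : Model p m => F z.2) z ∘L .inr ℝ _ _).toLinearMap =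
      LinearMap.range (fderiv ℝ (fun z : Model p m => F z.2) z).toLinearMap := by
  have h1 : fderiv ℝ (fun z : Model p m => F z.2) z =
      (fderiv ℝ F z.2).comp (.snd ℝ (EuclideanSpace ℝ (Fin p)) _) :=
    ((hF.differentiable (by simp) z.2).hasFDerivAt.comp z hasFDerivAt_snd).fderiv
  rw [h1]
  apply le_antisymm
  · rintro _ ⟨v, rfl⟩
    exact ⟨(0, v), rfl⟩
  · rintro _ ⟨v, rfl⟩
    exact ⟨v.2, rfl⟩

theorem IsNormalForm.eventually_finrank {S : System I M m}
    {h : Model p m → EuclideanSpace ℝ (Fin p)}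
    {φ : PartialDiffeomorph I 𝓘(ℝ, Model p m) M (Model p m) ∞} (hφ : IsNormalForm S h φ)
    {x₀ : M} (hx₀ : x₀ ∈ φ.source) {k : ℕ}
    (hk : ∀ᶠ x in 𝓝 x₀, Module.finrank ℝ (S.G1 x) = m + k) :
    ∀ᶠ z in 𝓝 (φ x₀), Module.finrank ℝ
      (LinearMap.range (fderiv ℝ h z ∘L .inr ℝ _ _).toLinearMap) = k := by
  filter_upwards [(tendsto_symm φ hx₀).eventually hk,
    φ.open_target.mem_nhds (apply_mem_target φ hx₀)] with z hz hzt
  have h1 := hφ.finrank_G1 (symm_mem_source φ hzt)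
  rw [hz, apply_symm_apply φ hzt] at h1
  omega

theorem locallyTrivialisable_iff_constant_rank (S : System I M m) (x₀ : M) (k : ℕ)
    (hk : ∀ᶠ x in 𝓝 x₀, Module.finrank ℝ (S.G1 x) = m + k) :
    (∃ (F : EuclideanSpace ℝ (Fin m) → EuclideanSpace ℝ (Fin p)) (hF : ContDiff ℝ ∞ F)
      (z₀ : Model p m), S.LocallyFeedbackEquivalent x₀ (trivialSystem F hF) z₀) ↔
    ∃ (h : Model p m → EuclideanSpace ℝ (Fin p)) (hh : ContDiff ℝ ∞ h) (z₀ : Model p m),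
      S.LocallyFeedbackEquivalent x₀ (extendedSystem h hh) z₀ ∧
      ∀ᶠ z in 𝓝 z₀, Module.finrank ℝ
        (Submodule.span ℝ (Set.range fun i => fderiv ℝ (fun y => h y i) z)) = k := by
  constructor
  · rintro ⟨F, hF, z₀, hS⟩
    have hF' := hF.comp (contDiff_snd (𝕜 := ℝ) (E := EuclideanSpace ℝ (Fin p)))
    refine ⟨_, hF', z₀, hS, ?_⟩
    obtain ⟨φ, hx₀, rfl, hφ⟩ := (locallyFeedbackEquivalent_extendedSystem_iff hF').1 hS
    filter_upwards [hφ.eventually_finrank hx₀ hk] with z hz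
    rw [finrank_span_fderiv_coordinates (hF'.differentiable (by simp) z)]
    exact (congrArg (fun R : Submodule ℝ (EuclideanSpace ℝ (Fin p)) => Module.finrank ℝ R)
      (fderiv_comp_snd_range hF z)).symm.trans hz
  · rintro ⟨h, hh, z₀, hS, hr⟩
    obtain ⟨φ, hx₀, rfl, hφ⟩ := (locallyFeedbackEquivalent_extendedSystem_iff hh).1 hS
    obtain ⟨Φ, F, hF, hz₀, hΦ, hΦF⟩ := exists_factorisation hh (k := k) (z₀ := φ x₀)
      (by
        filter_upwards [hr] with z hz
        rwa [finrank_span_fderiv_coordinates (hh.differentiable (by simp) z)] at hz)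
      (hφ.eventually_finrank hx₀ hk).self_of_nhds
    exact ⟨F, hF, _, (hφ.trans hΦ hΦF).locallyFeedbackEquivalent
      (hF.comp contDiff_snd) (show x₀ ∈ (φ.trans Φ).source from ⟨hx₀, hz₀⟩)⟩

end PartOne

/-! ### Translations as flows, and the symmetries of a trivial system. -/

section Translations

variable {E : Type*} [NormedAddCommGroup E] [NormedSpace ℝ E]
  {H : Type*} [TopologicalSpace H] {I : ModelWithCorners ℝ E H}
  {M : Type*} [TopologicalSpace M] [ChartedSpace H M]
  {F : Type*} [NormedAddCommGroup F] [NormedSpace ℝ F] {p m : ℕ}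

/-- A translation of a normed space, as a partial diffeomorphism. -/
def translation (a : F) : PartialDiffeomorph 𝓘(ℝ, F) 𝓘(ℝ, F) F F ∞ where
  toPartialEquiv := (Equiv.addRight a).toPartialEquiv
  open_source := isOpen_univ
  open_target := isOpen_univ
  contMDiffOn_toFun :=
    (contDiff_id.add contDiff_const : ContDiff ℝ ∞ fun z : F => z + a).contMDiff.contMDiffOn
  contMDiffOn_invFun :=
    (contDiff_id.add contDiff_const : ContDiff ℝ ∞ fun z : F => z + -a).contMDiff.contMDiffOn

theorem hasDerivAt_comp_of_hasMFDerivAt (φ : PartialDiffeomorph I 𝓘(ℝ, F) M F ∞) {γ : ℝ → M}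
    {t : ℝ} {v : TangentSpace I (γ t)} (hγ : HasMFDerivAt 𝓘(ℝ, ℝ) I γ t
      ((1 : ℝ →L[ℝ] ℝ).smulRight v)) (ht : γ t ∈ φ.source) :
    HasDerivAt (fun s => φ (γ s)) (differentialAt φ (γ t) v) t := by
  let L : ℝ →L[ℝ] F := (differentialAt φ (γ t)).comp ((1 : ℝ →L[ℝ] ℝ).smulRight v)
  have h1 : HasFDerivAt (fun s => φ (γ s)) L t := hasMFDerivAt_iff_hasFDerivAt.1
    (((contMDiffAt φ ht).mdifferentiableAt (by simp)).hasMFDerivAt.comp t hγ)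
  have h2 : L 1 = differentialAt φ (γ t) v := congrArg (differentialAt φ (γ t)) (one_smul ℝ v)
  rw [← h2]
  exact h1.hasDerivAt

theorem differentialAt_mfderiv_of_translation (φ : PartialDiffeomorph I 𝓘(ℝ, F) M F ∞)
    {γ : M → M} {d : F} {x : M} (hx : x ∈ φ.source) (hγx : γ x ∈ φ.source)
    (hγ : MDifferentiableAt I I γ x) (hd : ∀ᶠ y in 𝓝 x, φ (γ y) = φ y + d)
    (y : TangentSpace I x) :
    differentialAt φ (γ x) (mfderiv I I γ x y) = differentialAt φ x y := by
  have h1 := mfderiv_comp x ((contMDiffAt φ hγx).mdifferentiableAt (by simp)) hγ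
  have h2 : (φ ∘ γ) =ᶠ[𝓝 x] fun y => translation d (φ y) := hd
  have h3 := mfderiv_trans_apply φ (translation d) hx trivial y
  have h4 : mfderiv I 𝓘(ℝ, F) (φ ∘ γ) x y = mfderiv I 𝓘(ℝ, F) (φ.trans (translation d)) x y := by
    rw [h2.mfderiv_eq]
    rfl
  rw [h1, h3] at h4
  refine h4.trans ?_
  rw [mfderiv_eq_fderiv]
  have h5 : fderiv ℝ (translation d) (φ x) = ContinuousLinearMap.id ℝ F :=
    ((hasFDerivAt_id (φ x)).add_const d).fderiv
  rw [h5]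
  rfl

/-- Fields that are constant in the coordinates `φ` have the translations as flow. -/
theorem flow_eq_translation (φ : PartialDiffeomorph I 𝓘(ℝ, F) M F ∞)
    {v : (x : M) → TangentSpace I x} {c : F}
    (hv : ∀ x ∈ φ.source, differentialAt φ x (v x) = c) {W : Set M} {a b : ℝ} {γ : ℝ → M → M}
    (hγ : IsLocalFlow v φ.source W a b γ) {t : ℝ} (ht : t ∈ Set.Ioo a b) {x : M} (hx : x ∈ W) :
    φ (γ t x) = φ x + t • c := by
  have hd : ∀ s ∈ Set.Ioo a b, HasDerivAt (fun s => φ (γ s x) - s • c) 0 s := fun s hs => by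
    have h1 := hasDerivAt_comp_of_hasMFDerivAt φ
      ((hγ.curve x hx s hs).hasMFDerivAt (isOpen_Ioo.mem_nhds hs)) (hγ.mem s hs x hx)
    rw [hv _ (hγ.mem s hs x hx)] at h1
    have h2 : HasDerivAt (fun s => φ (γ s x) - s • c) (c - (1 : ℝ) • c) s :=
      h1.sub ((hasDerivAt_id s).smul_const c)
    rwa [one_smul, sub_self] at h2
  have h0 : (0 : ℝ) ∈ Set.Ioo a b := ⟨hγ.neg, hγ.pos⟩
  have h1 := (convex_Ioo a b).is_const_of_fderivWithin_eq_zero (𝕜 := ℝ)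
    (f := fun s => φ (γ s x) - s • c)
    (fun s hs => (hd s hs).differentiableAt.differentiableWithinAt)
    (fun s hs => by
      rw [fderivWithin_of_isOpen isOpen_Ioo hs]
      ext
      simpa using (hd s hs).deriv) ht h0
  simp only [hγ.zero x hx, zero_smul, sub_zero] at h1
  exact sub_eq_iff_eq_add.1 h1

/-- The vector fields that are constant and horizontal in the coordinates `φ`. -/
def horizontalFields (φ : PartialDiffeomorph I 𝓘(ℝ, Model p m) M (Model p m) ∞) :
    Submodule ℝ ((x : M) → TangentSpace I x) where
  carrier := {v | ∃ c, ∀ x ∈ φ.source, differentialAt φ x (v x) = (c, 0)}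
  zero_mem' := ⟨0, fun x _ => map_zero _⟩
  add_mem' := by
    rintro v w ⟨c, hc⟩ ⟨d, hd⟩
    refine ⟨c + d, fun x hx => ?_⟩
    rw [Pi.add_apply, map_add, hc x hx, hd x hx, Prod.mk_add_mk, add_zero]
  smul_mem' := by
    rintro r v ⟨c, hc⟩
    refine ⟨r • c, fun x hx => ?_⟩
    rw [Pi.smul_apply, map_smul, hc x hx, Prod.smul_mk, smul_zero]

open Classical in
theorem exists_horizontalFields_eq (φ : PartialDiffeomorph I 𝓘(ℝ, Model p m) M (Model p m) ∞)
    (c : EuclideanSpace ℝ (Fin p)) :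
    ∃ v ∈ horizontalFields φ, ∀ x ∈ φ.source, differentialAt φ x (v x) = (c, 0) := by
  have h1 : ∀ x ∈ φ.source,
      ∃ v : TangentSpace I x, differentialAt φ x v = ((c, 0) : Model p m) := fun x hx =>
    differentialAt_surjective φ hx _
  choose v hv using h1
  refine ⟨fun x => if hx : x ∈ φ.source then v x hx else 0, ⟨c, ?_⟩, ?_⟩ <;>
  · intro x hx
    simp only [dif_pos hx, hv]

variable [IsManifold I ∞ M]

/-- On the source, `v` is the pullback of the constant field `c`. -/
theorem smoothFieldOn_of_differentialAt_eq [CompleteSpace E]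
    (φ : PartialDiffeomorph I 𝓘(ℝ, F) M F ∞) {v : (x : M) → TangentSpace I x} {c : F}
    (hv : ∀ x ∈ φ.source, differentialAt φ x (v x) = c) : SmoothFieldOn I v φ.source := by
  have hI : IsManifold I 1 M := IsManifold.of_le (n := ∞) (by exact_mod_cast le_top)
  intro x hx
  have h1 : ContMDiffAt 𝓘(ℝ, F) 𝓘(ℝ, F).tangent ∞
      (fun z => (⟨z, c⟩ : TangentBundle 𝓘(ℝ, F) F)) (φ x) :=
    contMDiffAt_vectorSpace_iff_contDiffAt.2 (contDiffAt_const (c := c))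
  have h2 := h1.mpullback_vectorField_preimage (contMDiffAt φ hx) (m := ∞)
    ⟨tangentEquiv φ hx, rfl⟩ (by simp)
  refine (h2.congr_of_eventuallyEq ?_).contMDiffWithinAt
  filter_upwards [φ.open_source.mem_nhds hx] with y hy
  refine congrArg (Bundle.TotalSpace.mk y) ?_
  change v y = (mfderiv I 𝓘(ℝ, F) φ y).inverse c
  have h3 : (mfderiv I 𝓘(ℝ, F) φ y).inverse = (tangentEquiv φ hy).symm :=
    ContinuousLinearMap.inverse_equiv (tangentEquiv φ hy)
  rw [h3]
  exact ((tangentEquiv φ hy).symm_apply_eq.2 (hv y hy).symm).symm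

theorem mlieBracket_eq_zero_of_differentialAt_eq [CompleteSpace E] [CompleteSpace F]
    (φ : PartialDiffeomorph I 𝓘(ℝ, F) M F ∞) {v w : (x : M) → TangentSpace I x} {c d : F}
    (hv : ∀ x ∈ φ.source, differentialAt φ x (v x) = c)
    (hw : ∀ x ∈ φ.source, differentialAt φ x (w x) = d) {x : M} (hx : x ∈ φ.source) :
    VectorField.mlieBracket I v w x = 0 := by
  have h1 := mfderiv_mlieBracket φ (smoothFieldOn_of_differentialAt_eq φ hv)
    (smoothFieldOn_of_differentialAt_eq φ hw) φ.open_source hx hx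
  have h2 (u : (x : M) → TangentSpace I x) (e : F)
      (hu : ∀ x ∈ φ.source, differentialAt φ x (u x) = e) :
      pushField φ u =ᶠ[𝓝 (φ x)] fun _ => e := by
    filter_upwards [φ.open_target.mem_nhds (apply_mem_target φ hx)] with z hz
    have h3 := pushField_eq_differentialAt φ u (symm_mem_source φ hz)
    rw [apply_symm_apply φ hz] at h3
    rw [h3, hu _ (symm_mem_source φ hz)]
  refine differentialAt_injective φ hx ?_
  rw [map_zero]
  refine h1.trans ?_
  rw [(h2 v c hv).lieBracket_vectorField_eq (h2 w d hw)]
  simp [VectorField.lieBracket]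
  rfl

namespace IsNormalForm

variable {S : System I M m} {k : EuclideanSpace ℝ (Fin m) → EuclideanSpace ℝ (Fin p)}
  {φ : PartialDiffeomorph I 𝓘(ℝ, Model p m) M (Model p m) ∞}

/-- Vertical fields have vertical brackets: this is `fst_lieBracket` with horizontal part `0`. -/
theorem involutiveOn {h : Model p m → EuclideanSpace ℝ (Fin p)} (hφ : IsNormalForm S h φ) :
    S.InvolutiveOn φ.source := by
  intro X Y hX hY hXG hYG x hx
  have hz : ∀ᶠ z in 𝓝 (φ x), z ∈ φ.target := φ.open_target.mem_nhds (apply_mem_target φ hx)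
  have h0 (Z : (x : M) → TangentSpace I x) (hZ : ∀ x ∈ φ.source, Z x ∈ S.G x) :
      ∀ᶠ z in 𝓝 (φ x), (pushField φ Z z).1 = 0 := by
    filter_upwards [hz] with z hz
    have hs := symm_mem_source φ hz
    have h3 := pushField_eq_differentialAt φ Z hs
    rw [apply_symm_apply φ hz] at h3
    rw [h3]
    exact (hφ.mem_G_iff hs _).1 (hZ _ hs)
  rw [hφ.mem_G_iff hx, show differentialAt φ x _ = _ from
    mfderiv_mlieBracket φ hX hY φ.open_source hx hx, fst_lieBracket (k := fun _ => 0)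
    ((contDiffAt_pushField φ hX φ.open_source hx hx).differentiableAt (by simp))
    ((contDiffAt_pushField φ hY φ.open_source hx hx).differentiableAt (by simp))
    (h0 X hXG) (h0 Y hYG)]
  simp

/-- In the coordinates the flow is a translation in `x`. It preserves `w`, hence the horizontal
velocity `k w` that determines `𝒜`. -/
theorem isLocalSymmetryOn (hφ : IsNormalForm S (fun z => k z.2) φ)
    {v : (x : M) → TangentSpace I x} {c : EuclideanSpace ℝ (Fin p)}
    (hv : ∀ x ∈ φ.source, differentialAt φ x (v x) = (c, 0)) {W : Set M} {a b : ℝ}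
    {γ : ℝ → M → M} (hγ : IsLocalFlow v φ.source W a b γ) {t : ℝ} (ht : t ∈ Set.Ioo a b) :
    S.IsLocalSymmetryOn (γ t) W := by
  set d : Model p m := t • ((c, 0) : Model p m) with hd
  have hflow : ∀ x ∈ W, φ (γ t x) = φ x + d := fun x hx => flow_eq_translation φ hv hγ ht hx
  have hWs : ∀ x ∈ W, x ∈ φ.source := fun x hx => by
    have := hγ.mem 0 ⟨hγ.neg, hγ.pos⟩ x hx
    rwa [hγ.zero x hx] at this
  have hts : ∀ x ∈ W, γ t x ∈ φ.source := fun x hx => hγ.mem t ht x hx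
  -- `IsLocalFlow` does not assume smoothness in the initial point; it follows from the formula `γ t
  -- = φ⁻¹ ∘ translation ∘ φ` on `W`.
  have hloc : IsLocalDiffeomorphOn I I ∞ (γ t) W := by
    rintro ⟨x, hx⟩
    refine ⟨restrictOpen ((φ.trans (translation d)).trans φ.symm) W hγ.isOpen,
      ⟨⟨⟨hWs x hx, trivial⟩, ?_⟩, hx⟩, ?_⟩
    · change φ x + d ∈ φ.target
      rw [← hflow x hx]
      exact apply_mem_target φ (hts x hx)
    · rintro y ⟨-, hy⟩
      change γ t y = φ.symm (φ y + d)
      rw [← hflow y hy, symm_apply_apply φ (hts y hy)]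
  refine ⟨hloc, fun x hx => ?_⟩
  have hD (y : TangentSpace I x) :
      differentialAt φ (γ t x) (mfderiv I I (γ t) x y) = differentialAt φ x y :=
    differentialAt_mfderiv_of_translation φ (hWs x hx) (hts x hx)
      ((hloc ⟨x, hx⟩).contMDiffAt.mdifferentiableAt (by simp))
      (by filter_upwards [hγ.isOpen.mem_nhds hx] with y hy using hflow y hy) y
  have hF : k (φ (γ t x)).2 = k (φ x).2 := by
    rw [hflow x hx, hd]
    simp
  ext y'
  rw [hφ.mem_A_iff (hts x hx), hF]
  constructor
  · rintro ⟨y, hy, rfl⟩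
    rw [hD]
    exact (hφ.mem_A_iff (hWs x hx) y).1 hy
  · intro hy'
    obtain ⟨y, hy⟩ := differentialAt_surjective φ (hWs x hx) (differentialAt φ (γ t x) y')
    refine ⟨y, (hφ.mem_A_iff (hWs x hx) y).2 (by rw [hy, hy']), ?_⟩
    exact differentialAt_injective φ (hts x hx) ((hD y).trans hy)

end IsNormalForm

theorem IsNormalForm.exists_abelian [CompleteSpace E] {S : System I M m}
    {k : EuclideanSpace ℝ (Fin m) → EuclideanSpace ℝ (Fin p)}
    {φ : PartialDiffeomorph I 𝓘(ℝ, Model p m) M (Model p m) ∞}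
    (hφ : IsNormalForm S (fun z => k z.2) φ) {x₀ : M} (hx₀ : x₀ ∈ φ.source) :
    ∃ U : Set M, IsOpen U ∧ x₀ ∈ U ∧ S.InvolutiveOn U ∧
      (∀ x ∈ U, Module.finrank ℝ (S.G x) = m) ∧
      ∃ 𝔞 : Submodule ℝ ((x : M) → TangentSpace I x),
        S.IsAbelianSymmetryAlgebraOn U 𝔞 ∧
        IsCompl (𝔞.map (LinearMap.proj x₀)) (S.G x₀) := by
  refine ⟨φ.source, φ.open_source, hx₀, hφ.involutiveOn, fun x hx => ?_, horizontalFields φ,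
    ⟨?_, ?_⟩, ?_⟩
  · have h1 := finrank_span_eq_card (hφ.linearIndependent x hx)
    rwa [Fintype.card_fin] at h1
  · rintro v ⟨c, hv⟩
    exact ⟨smoothFieldOn_of_differentialAt_eq φ hv,
      fun W a b γ hγ t ht => hφ.isLocalSymmetryOn hv hγ ht⟩
  · rintro v ⟨c, hv⟩ w ⟨d, hw⟩ x hx
    exact mlieBracket_eq_zero_of_differentialAt_eq φ hv hw hx
  · refine IsCompl.of_le (fun y hy => ?_) (fun y _ => ?_)
    · obtain ⟨⟨v, ⟨c, hv⟩, rfl⟩, hG⟩ := hy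
      have h1 := (hφ.mem_G_iff hx₀ _).1 hG
      rw [LinearMap.proj_apply, hv x₀ hx₀] at h1
      have h2 := hv x₀ hx₀
      rw [show c = 0 from h1] at h2
      exact differentialAt_injective φ hx₀ (h2.trans (map_zero _).symm)
    · obtain ⟨v, hv, hvc⟩ := exists_horizontalFields_eq φ (differentialAt φ x₀ y).1
      have h1 : y - v x₀ ∈ S.G x₀ := by
        rw [hφ.mem_G_iff hx₀, map_sub, hvc x₀ hx₀]
        simp
      rw [← add_sub_cancel (v x₀) y]
      exact Submodule.add_mem_sup ⟨v, hv, rfl⟩ h1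

end Translations

/-! ### Simultaneous straightening of commuting fields. -/

section Straightening

variable {E C K : Type} [NormedAddCommGroup E] [NormedSpace ℝ E] [FiniteDimensional ℝ E]
  [NormedAddCommGroup C] [NormedSpace ℝ C]
  [NormedAddCommGroup K] [NormedSpace ℝ K] [FiniteDimensional ℝ K]
  {M : Type*} [TopologicalSpace M] [ChartedSpace E M] [IsManifold 𝓘(ℝ, E) ∞ M]

/-- In the coordinates `χ`, a linear family of vector fields is a smooth map to the linear maps. -/
theorem exists_contDiff_family [FiniteDimensional ℝ C]
    (χ : PartialDiffeomorph 𝓘(ℝ, E) 𝓘(ℝ, E) M E ∞)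
    (v : C →ₗ[ℝ] (x : M) → TangentSpace 𝓘(ℝ, E) x) {U : Set M} (hU : IsOpen U)
    (hv : ∀ c, SmoothFieldOn 𝓘(ℝ, E) (v c) U) {x₀ : M} (hx₀ : x₀ ∈ χ.source) (hx₀U : x₀ ∈ U) :
    ∃ V : E → C →L[ℝ] E, ContDiff ℝ ∞ V ∧
      ∀ᶠ z in 𝓝 (χ x₀), ∀ c, V z c = pushField χ (v c) z := by
  let V : E → C →L[ℝ] E := fun z => LinearMap.toContinuousLinearMap
    { toFun := fun c => pushField χ (v c) z
      map_add' := fun c d => by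
        unfold pushField
        rw [map_add, Pi.add_apply, map_add]
        rfl
      map_smul' := fun r c => by
        unfold pushField
        rw [map_smul, Pi.smul_apply, map_smul]
        rfl }
  have hV : ∀ᶠ z in 𝓝 (χ x₀), ContDiffAt ℝ ∞ V z := by
    have hO : ∀ᶠ z in 𝓝 (χ x₀), z ∈ χ.target ∧ χ.symm z ∈ U :=
      Filter.Eventually.and (χ.open_target.mem_nhds (apply_mem_target χ hx₀))
        ((tendsto_symm χ hx₀).eventually (hU.mem_nhds hx₀U))
    obtain ⟨O, hOs, hO, hxO⟩ := eventually_nhds_iff.1 hO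
    have h1 : ContDiffOn ℝ ∞ V O := contDiffOn_clm_apply.2 fun c z hz => by
      have h2 := contDiffAt_pushField χ (hv c) hU (symm_mem_source χ (hOs z hz).1) (hOs z hz).2
      rw [apply_symm_apply χ (hOs z hz).1] at h2
      exact h2.contDiffWithinAt
    filter_upwards [hO.mem_nhds hxO] with z hz using h1.contDiffAt (hO.mem_nhds hz)
  obtain ⟨V', hV', hVV'⟩ := exists_contDiff_eventuallyEq hV
  refine ⟨V', hV', hVV'.mono fun z hz c => ?_⟩
  rw [hz]
  rfl

/-- Vanishing of the brackets, written in the chart, is the commutation hypothesis of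
`exists_commuting_flow`. -/
theorem eventually_fderiv_symmetric (χ : PartialDiffeomorph 𝓘(ℝ, E) 𝓘(ℝ, E) M E ∞)
    {v : C →ₗ[ℝ] (x : M) → TangentSpace 𝓘(ℝ, E) x} {U : Set M} (hU : IsOpen U)
    (hv : ∀ c, SmoothFieldOn 𝓘(ℝ, E) (v c) U)
    (hcomm : ∀ c d, ∀ x ∈ U, VectorField.mlieBracket 𝓘(ℝ, E) (v c) (v d) x = 0)
    {x₀ : M} (hx₀ : x₀ ∈ χ.source) (hx₀U : x₀ ∈ U) {V : E → C →L[ℝ] E} (hV : ContDiff ℝ ∞ V)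
    (hVv : ∀ᶠ z in 𝓝 (χ x₀), ∀ c, V z c = pushField χ (v c) z) :
    ∀ᶠ z in 𝓝 (χ x₀), ∀ c d, fderiv ℝ V z (V z c) d = fderiv ℝ V z (V z d) c := by
  filter_upwards [hVv.eventually_nhds, χ.open_target.mem_nhds (apply_mem_target χ hx₀),
    (tendsto_symm χ hx₀).eventually (hU.mem_nhds hx₀U)] with z hz hzt hzU c d
  have h1 := mfderiv_mlieBracket χ (hv c) (hv d) hU (symm_mem_source χ hzt) hzU
  have h2 (e : C) : fderiv ℝ (pushField χ (v e)) z = (fderiv ℝ V z).flip e := by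
    have h3 : pushField χ (v e) =ᶠ[𝓝 z] fun y => V y e := hz.mono fun y hy => (hy e).symm
    rw [h3.fderiv_eq]
    have h4 := ((hV.differentiable (by simp) z).hasFDerivAt.clm_apply
      (hasFDerivAt_const e z)).fderiv
    rw [h4]
    ext y
    simp
  rw [hcomm c d _ hzU, map_zero, apply_symm_apply χ hzt, VectorField.lieBracket, h2, h2,
    ← hz.self_of_nhds c, ← hz.self_of_nhds d] at h1
  exact sub_eq_zero.1 h1.symm

/-- **Simultaneous straightening** of commuting vector fields. -/
theorem exists_straightening [FiniteDimensional ℝ C]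
    (v : C →ₗ[ℝ] (x : M) → TangentSpace 𝓘(ℝ, E) x) {U : Set M}
    (hU : IsOpen U) (hv : ∀ c, SmoothFieldOn 𝓘(ℝ, E) (v c) U)
    (hcomm : ∀ c d, ∀ x ∈ U, VectorField.mlieBracket 𝓘(ℝ, E) (v c) (v d) x = 0)
    {x₀ : M} (hx₀ : x₀ ∈ U) (e : (C × K) ≃L[ℝ] TangentSpace 𝓘(ℝ, E) x₀)
    (he : ∀ c, e (c, 0) = v c x₀) :
    ∃ Φ : PartialDiffeomorph 𝓘(ℝ, E) 𝓘(ℝ, C × K) M (C × K) ∞, x₀ ∈ Φ.source ∧ Φ.source ⊆ U ∧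
      Φ x₀ = 0 ∧ ∀ x ∈ Φ.source, ∀ c, differentialAt Φ x (v c x) = (c, 0) := by
  let χ := chartDiffeomorph (E := E) x₀
  have hχ : x₀ ∈ χ.source := mem_chart_source E x₀
  set z₁ : E := χ x₀ with hz₁
  obtain ⟨V, hV, hVv⟩ := exists_contDiff_family χ v hU hv hχ hx₀
  obtain ⟨Ψ, hΨ, hΨ0, hΨV⟩ := exists_commuting_flow hV z₁
    (eventually_fderiv_symmetric χ hU hv hcomm hχ hx₀ hV hVv)
  let e' : (C × K) ≃L[ℝ] E := e.trans (tangentEquiv χ hχ)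
  let A : (C × K) →L[ℝ] C × E :=
    (ContinuousLinearMap.fst ℝ C K).prod (e'.toContinuousLinearMap ∘L .inr ℝ C K ∘L .snd ℝ C K)
  -- The straightening chart is the inverse of `f`: start at the point of a transversal with
  -- parameter in `K`, then follow the joint flow with parameter in `C`.
  let f : C × K → E := fun q => Ψ (A q + (0, z₁))
  have hA : Filter.Tendsto (fun q => A q + (0, z₁)) (𝓝 0) (𝓝 ((0, z₁) : C × E)) := by
    have : ContinuousAt (fun q => A q + (0, z₁)) 0 := by fun_prop
    simpa [ContinuousAt] using this
  have hAd (q : C × K) : HasFDerivAt (fun q => A q + (0, z₁)) A q := A.hasFDerivAt.add_const _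
  have hf0 : f 0 = z₁ := by
    have h1 : f 0 = Ψ (0, z₁) := by simp [f]
    rw [h1, hΨ0.self_of_nhds]
  have hfs : ∀ᶠ q in 𝓝 0, ContDiffAt ℝ ∞ f q := (hA.eventually hΨ).mono fun q hq =>
    ContDiffAt.comp q (g := Ψ) hq (A.contDiff.add contDiff_const).contDiffAt
  have hfc : ∀ᶠ q in 𝓝 0, ∀ c, fderiv ℝ f q (c, 0) = V (f q) c := by
    filter_upwards [hA.eventually hΨ, hA.eventually hΨV] with q hq hqV c
    have h1 : HasFDerivAt f ((fderiv ℝ Ψ (A q + (0, z₁))).comp A) q :=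
      HasFDerivAt.comp q (g := Ψ) (hq.differentiableAt (by simp)).hasFDerivAt (hAd q)
    rw [h1.fderiv, ContinuousLinearMap.comp_apply, ← hqV c]
    congr 1
    simp [A]
  -- In the `C`-directions the derivative is given by the flow equation, in the `K`-directions by `Ψ
  -- (0, z) = z`.
  have hfd : HasFDerivAt f (e' : (C × K) →L[ℝ] E) 0 := by
    have h1 := (hfs.self_of_nhds.differentiableAt (by simp)).hasFDerivAt
    suffices fderiv ℝ f 0 = e' by rwa [this] at h1
    have h2 : HasFDerivAt f ((fderiv ℝ Ψ (0, z₁)).comp A) 0 := by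
      have h3 := (hΨ.self_of_nhds.differentiableAt (by simp)).hasFDerivAt
      refine HasFDerivAt.comp 0 (g := Ψ) ?_ (hAd 0)
      simpa using h3
    have h4 (y : E) : fderiv ℝ Ψ (0, z₁) (0, y) = y := by
      have h3 := (hΨ.self_of_nhds.differentiableAt (by simp)).hasFDerivAt
      have h5 : HasFDerivAt (fun z : E => ((0 : C), z)) (.inr ℝ C E) z₁ :=
        hasFDerivAt_prodMk_right 0 z₁
      have h6 := HasFDerivAt.comp z₁ (g := Ψ) (f := fun z : E => ((0 : C), z)) h3 h5
      have h7 : (Ψ ∘ fun z : E => ((0 : C), z)) =ᶠ[𝓝 z₁] id := hΨ0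
      have h8 := (h6.congr_of_eventuallyEq h7.symm).unique (hasFDerivAt_id z₁)
      exact DFunLike.congr_fun h8 y
    refine ContinuousLinearMap.ext fun q => ?_
    have h9 : q = (q.1, 0) + (0, q.2) := by simp
    have h10 : fderiv ℝ f 0 (q.1, 0) = e' (q.1, 0) := by
      rw [hfc.self_of_nhds, hf0, hVv.self_of_nhds]
      refine (pushField_apply χ (v q.1) hχ).trans ?_
      rw [← he]
      rfl
    have h11 : fderiv ℝ f 0 (0, q.2) = e' (0, q.2) := by
      rw [h2.fderiv, ContinuousLinearMap.comp_apply, ← h4 (e' (0, q.2))]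
      congr 1
    rw [h9, map_add, h10, h11]
    exact (map_add e' _ _).symm
  obtain ⟨ψ', hψ0', hψf'⟩ := exists_partialDiffeomorph hfs e' hfd
  have hft : Filter.Tendsto f (𝓝 0) (𝓝 z₁) := by
    have h1 := hfd.continuousAt
    rwa [ContinuousAt, hf0] at h1
  obtain ⟨ψ, hψ0, -, hψψ', -, hψP⟩ := exists_restrict ψ' hψ0' (hfc.and ((hft.eventually hVv).and
    (hft.eventually ((tendsto_symm χ hχ).eventually (hU.mem_nhds hx₀)))))
  have hψf : ⇑ψ = f := funext fun q => (hψψ' q).trans (hψf' q)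
  have hψz : ψ 0 = z₁ := (congrFun hψf 0).trans hf0
  have hψs : ψ.symm z₁ = 0 := by rw [← hψz, symm_apply_apply ψ hψ0]
  refine ⟨χ.trans ψ.symm, ⟨hχ, ?_⟩, fun x hx => ?_, hψs, fun x hx c => ?_⟩
  · change z₁ ∈ ψ.target
    rw [← hψz]
    exact apply_mem_target ψ hψ0
  · have h1 : χ x ∈ ψ.target := hx.2
    have h2 := (hψP _ (symm_mem_source ψ h1)).2.2
    rwa [← congrFun hψf, apply_symm_apply ψ h1, symm_apply_apply χ hx.1] at h2
  · have h1 : χ x ∈ ψ.target := hx.2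
    have h2 := hψP _ (symm_mem_source ψ h1)
    have h3 := h2.1 c
    rw [h2.2.1 c, ← hψf, apply_symm_apply ψ h1, pushField_eq_differentialAt χ _ hx.1] at h3
    rw [differentialAt_trans χ ψ.symm hx.1 h1, ← h3]
    have h4 := fderiv_apply_fderiv_symm ψ.symm (symm_mem_source ψ h1) (c, (0 : K))
    have h5 : ψ.symm.symm (ψ.symm (χ x)) = χ x := apply_symm_apply ψ h1
    rw [h5] at h4
    exact h4

end Straightening

/-! ### Invariance of the admissible velocities under translations. -/

section Invariance

variable {E : Type*} [NormedAddCommGroup E] [NormedSpace ℝ E]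
  {H : Type*} [TopologicalSpace H] {I : ModelWithCorners ℝ E H}
  {M : Type*} [TopologicalSpace M] [ChartedSpace H M]
  {F : Type*} [NormedAddCommGroup F] [NormedSpace ℝ F] {p m : ℕ}

/-- A symmetry is defined by a condition on all its local flows; using that condition requires an
actual flow, which the translations provide. -/
theorem isLocalFlow_translation (φ : PartialDiffeomorph I 𝓘(ℝ, F) M F ∞) {U W : Set M}
    (hφU : φ.source ⊆ U) {v : (x : M) → TangentSpace I x} {c : F}
    (hv : ∀ x ∈ φ.source, differentialAt φ x (v x) = c) (hW : IsOpen W) (hWs : W ⊆ φ.source)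
    {a b : ℝ} (ha : a < 0) (hb : 0 < b)
    (ht : ∀ x ∈ W, ∀ t ∈ Set.Ioo a b, φ x + t • c ∈ φ.target) :
    IsLocalFlow v U W a b fun t x => φ.symm (φ x + t • c) where
  isOpen := hW
  neg := ha
  pos := hb
  zero x hx := by
    rw [zero_smul, add_zero]
    exact symm_apply_apply φ (hWs hx)
  mem t hts x hx := hφU (symm_mem_source φ (ht x hx t hts))
  curve x hx t hts := by
    have hy := ht x hx t hts
    have h1 : HasFDerivAt (fun s : ℝ => φ x + s • c) ((1 : ℝ →L[ℝ] ℝ).smulRight c) t :=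
      ((hasFDerivAt_id t).smul_const c).const_add (φ x)
    have h2 := HasMFDerivAt.comp t (g := φ.symm) (f := fun s : ℝ => φ x + s • c)
      ((contMDiffAt_symm φ hy).mdifferentiableAt (by simp)).hasMFDerivAt h1.hasMFDerivAt
    refine HasMFDerivAt.hasMFDerivWithinAt (h2.congr_mfderiv ?_)
    refine ContinuousLinearMap.ext fun s : ℝ => ?_
    have h3 := mfderiv_symm_comp φ (symm_mem_source φ hy)
    rw [apply_symm_apply φ hy] at h3
    have h4 := DFunLike.congr_fun h3 (v (φ.symm (φ x + t • c)))
    have h5 : mfderiv 𝓘(ℝ, F) I φ.symm (φ x + t • c) c = v (φ.symm (φ x + t • c)) := by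
      refine Eq.trans ?_ h4
      exact congrArg (mfderiv 𝓘(ℝ, F) I φ.symm (φ x + t • c)) (hv _ (symm_mem_source φ hy)).symm
    change mfderiv 𝓘(ℝ, F) I φ.symm (φ x + t • c) (s • c) = s • v (φ.symm (φ x + t • c))
    rw [← h5]
    exact map_smul (mfderiv 𝓘(ℝ, F) I φ.symm (φ x + t • c)) s c

variable [IsManifold I ∞ M]

/-- Symmetries that are constant in the coordinates `φ` leave the admissible velocities invariant
under translations. -/
theorem System.IsInfinitesimalSymmetryOn.image_A_eq {S : System I M m}
    {φ : PartialDiffeomorph I 𝓘(ℝ, F) M F ∞} {U : Set M} (hφU : φ.source ⊆ U)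
    {v : (x : M) → TangentSpace I x} (hS : S.IsInfinitesimalSymmetryOn U v) {c : F}
    (hv : ∀ x ∈ φ.source, differentialAt φ x (v x) = c) {r : ℝ}
    (hr : Metric.ball 0 (3 * r) ⊆ φ.target) (hc : ‖c‖ < r) {x x' : M} (hx : x ∈ φ.source)
    (hxr : ‖φ x‖ < r) (hx' : x' ∈ φ.source) (hxx' : φ x' = φ x + c) :
    differentialAt φ x' '' S.A x' = differentialAt φ x '' S.A x := by
  have hWo : IsOpen (φ.source ∩ φ ⁻¹' Metric.ball 0 r) :=
    φ.toOpenPartialHomeomorph.isOpen_inter_preimage Metric.isOpen_ball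
  -- The interval `(-2, 2)` contains time `1`; with `‖φ y‖` and `‖c‖` below `r`, the translates stay
  -- in the ball of radius `3 * r`.
  have hWt : ∀ y ∈ φ.source ∩ φ ⁻¹' Metric.ball 0 r, ∀ t ∈ Set.Ioo (-2 : ℝ) 2,
      φ y + t • c ∈ φ.target := by
    rintro y ⟨-, hy⟩ t ht
    refine hr (mem_ball_zero_iff.2 ?_)
    have h1 : ‖φ y‖ < r := mem_ball_zero_iff.1 hy
    have h2 : ‖t • c‖ ≤ 2 * ‖c‖ := by
      rw [norm_smul]
      exact mul_le_mul_of_nonneg_right (abs_le.2 ⟨ht.1.le, ht.2.le⟩) (norm_nonneg c)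
    linarith [norm_add_le (φ y) (t • c)]
  have hflow := isLocalFlow_translation φ hφU hv hWo Set.inter_subset_left (by norm_num)
    (by norm_num) hWt
  have h1 : (1 : ℝ) ∈ Set.Ioo (-2 : ℝ) 2 := by norm_num
  have hxW : x ∈ φ.source ∩ φ ⁻¹' Metric.ball 0 r := ⟨hx, mem_ball_zero_iff.2 hxr⟩
  obtain ⟨hloc, himg⟩ := hS.2 _ _ _ _ hflow 1 h1
  have hγx : φ.symm (φ x + (1 : ℝ) • c) = x' := by
    rw [one_smul, ← hxx', symm_apply_apply φ hx']
  have h2 := differentialAt_mfderiv_of_translation φ (γ := fun x => φ.symm (φ x + (1 : ℝ) • c))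
    (d := c) hx (by rwa [hγx]) ((hloc ⟨x, hxW⟩).contMDiffAt.mdifferentiableAt (by simp)) (by
      filter_upwards [hWo.mem_nhds hxW] with y hy
      rw [apply_symm_apply φ (hWt y hy 1 h1), one_smul])
  have h3 := himg x hxW
  rw [← hγx]
  beta_reduce at h3
  rw [← h3, Set.image_image]
  exact Set.image_congr fun y _ => h2 y

/-- Invariance of the admissible velocities under horizontal translations, in terms of the fields
of the system. -/
theorem eventually_exists_eq_sum {S : System I M m}
    {φ : PartialDiffeomorph I 𝓘(ℝ, Model p m) M (Model p m) ∞} {U : Set M} (hφU : φ.source ⊆ U)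
    {v : EuclideanSpace ℝ (Fin p) → (x : M) → TangentSpace I x}
    (hS : ∀ c, S.IsInfinitesimalSymmetryOn U (v c))
    (hv : ∀ x ∈ φ.source, ∀ c, differentialAt φ x (v c x) = (c, 0)) (h0 : 0 ∈ φ.target) :
    ∀ᶠ z in 𝓝 (0 : Model p m),
      (∃ a : Fin m → ℝ, pushField φ S.f z =
        pushField φ S.f (0, z.2) + ∑ j, a j • pushField φ (S.g j) (0, z.2)) ∧
      ∀ i, ∃ a : Fin m → ℝ, pushField φ (S.g i) z =
        ∑ j, a j • pushField φ (S.g j) (0, z.2) := by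
  obtain ⟨ε, hε, hεt⟩ := Metric.isOpen_iff.1 φ.open_target 0 h0
  set r := ε / 3 with hr
  have hr3 : 3 * r = ε := by rw [hr]; ring
  filter_upwards [Metric.ball_mem_nhds (0 : Model p m) (show 0 < r by positivity)] with z hz
  have hzr : ‖z‖ < r := mem_ball_zero_iff.1 hz
  have hz1 : ‖(-z.1, (0 : EuclideanSpace ℝ (Fin m)))‖ < r := by
    rw [Prod.norm_mk, norm_zero, norm_neg, max_lt_iff]
    exact ⟨(norm_fst_le z).trans_lt hzr, (norm_nonneg z).trans_lt hzr⟩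
  have hz2 : ‖((0 : EuclideanSpace ℝ (Fin p)), z.2)‖ < r := by
    rw [Prod.norm_mk, norm_zero, max_lt_iff]
    exact ⟨(norm_nonneg z).trans_lt hzr, (norm_snd_le z).trans_lt hzr⟩
  have hzt : ∀ y : Model p m, ‖y‖ < r → y ∈ φ.target := fun y hy =>
    hεt (mem_ball_zero_iff.2 (by linarith [norm_nonneg y]))
  have hx := symm_mem_source φ (hzt z hzr)
  have hx' := symm_mem_source φ (hzt _ hz2)
  have hφz := apply_symm_apply φ (hzt z hzr)
  have hφz' := apply_symm_apply φ (hzt _ hz2)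
  -- The translation by `(-z.1, 0)` takes `z` to `(0, z.2)`.
  have h1 := (hS (-z.1)).image_A_eq hφU (fun x hx => hv x hx (-z.1)) (by rwa [hr3]) hz1 hx
    (by rwa [hφz]) hx' (by rw [hφz, hφz']; ext <;> simp)
  have h2 (a : Fin m → ℝ) : ∃ b : Fin m → ℝ,
      pushField φ S.f z + ∑ i, a i • pushField φ (S.g i) z =
        pushField φ S.f (0, z.2) + ∑ j, b j • pushField φ (S.g j) (0, z.2) := by
    have h3 : differentialAt φ (φ.symm z) (S.f (φ.symm z) + ∑ i, a i • S.g i (φ.symm z)) ∈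
        differentialAt φ (φ.symm z) '' S.A (φ.symm z) := ⟨_, ⟨a, rfl⟩, rfl⟩
    rw [← h1] at h3
    obtain ⟨_, ⟨b, rfl⟩, hb⟩ := h3
    refine ⟨b, ?_⟩
    simp only [map_add, map_sum, map_smul] at hb
    exact hb.symm
  -- Zero control gives the relation for `f`; subtracting it from the relation for the `i`-th unit
  -- control gives the one for `g i`.
  obtain ⟨a, ha⟩ := h2 0
  simp only [Pi.zero_apply, zero_smul, Finset.sum_const_zero, add_zero] at ha
  refine ⟨⟨a, ha⟩, fun i => ?_⟩
  obtain ⟨b, hb⟩ := h2 (Pi.single i 1)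
  refine ⟨b - a, ?_⟩
  have h4 : ∑ j, (Pi.single i 1 : Fin m → ℝ) j • pushField φ (S.g j) z =
      pushField φ (S.g i) z := by
    rw [Finset.sum_eq_single i] <;> simp +contextual
  rw [h4, ha, add_assoc, add_right_inj] at hb
  simp only [Pi.sub_apply, sub_smul, Finset.sum_sub_distrib, ← hb, add_sub_cancel_left]

end Invariance

/-! ### Translation-invariant distributions as graphs. -/

section Graph

variable {p m : ℕ}

theorem eventually_tendsto_vertical : Filter.Tendsto
    (fun w : EuclideanSpace ℝ (Fin m) => ((0, w) : Model p m)) (𝓝 0) (𝓝 0) := by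
  have h1 : Continuous fun w : EuclideanSpace ℝ (Fin m) => ((0, w) : Model p m) := by fun_prop
  exact h1.tendsto' 0 0 rfl

theorem tendsto_snd_zero : Filter.Tendsto (fun z : Model p m => z.2) (𝓝 0) (𝓝 0) :=
  continuous_snd.tendsto' 0 0 rfl

theorem isInvertible_sum_smulRight {d : Fin m → EuclideanSpace ℝ (Fin m)}
    (hd : LinearIndependent ℝ d) :
    (∑ j, (EuclideanSpace.proj j : EuclideanSpace ℝ (Fin m) →L[ℝ] ℝ).smulRight
      (d j)).IsInvertible := by
  set Q : EuclideanSpace ℝ (Fin m) →L[ℝ] EuclideanSpace ℝ (Fin m) :=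
    ∑ j, (EuclideanSpace.proj j : EuclideanSpace ℝ (Fin m) →L[ℝ] ℝ).smulRight (d j) with hQ
  have hQu (u : EuclideanSpace ℝ (Fin m)) : Q u = ∑ j, u j • d j := by
    simp [hQ]
  have hinj : Function.Injective Q.toLinearMap := by
    rw [← LinearMap.ker_eq_bot, LinearMap.ker_eq_bot']
    intro u hu
    ext i
    exact Fintype.linearIndependent_iff.1 hd (fun j => u j) ((hQu u).symm.trans hu) i
  exact ⟨(LinearEquiv.ofInjectiveEndo Q.toLinearMap hinj).toContinuousLinearEquiv,
    ContinuousLinearMap.ext fun u => rfl⟩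

/-- Fields whose affine span does not depend on `x` span the graphs of linear maps that depend only
on `w`. -/
theorem exists_graph {f : Model p m → Model p m} {g : Fin m → Model p m → Model p m}
    (hf : ∀ᶠ z in 𝓝 0, ContDiffAt ℝ ∞ f z) (hg : ∀ i, ∀ᶠ z in 𝓝 0, ContDiffAt ℝ ∞ (g i) z)
    (hli : LinearIndependent ℝ fun i => (g i 0).2)
    (hfg : ∀ᶠ z in 𝓝 (0 : Model p m),
      (∃ a : Fin m → ℝ, f z = f (0, z.2) + ∑ j, a j • g j (0, z.2)) ∧
      ∀ i, ∃ a : Fin m → ℝ, g i z = ∑ j, a j • g j (0, z.2)) :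
    ∃ (b : EuclideanSpace ℝ (Fin m) → EuclideanSpace ℝ (Fin m) →L[ℝ] EuclideanSpace ℝ (Fin p))
      (F : EuclideanSpace ℝ (Fin m) → EuclideanSpace ℝ (Fin p)),
      (∀ᶠ w in 𝓝 0, ContDiffAt ℝ ∞ b w) ∧ (∀ᶠ w in 𝓝 0, ContDiffAt ℝ ∞ F w) ∧
      ∀ᶠ z in 𝓝 (0 : Model p m), (∀ i, (g i z).1 = b z.2 (g i z).2) ∧
        (f z).1 = b z.2 (f z).2 + F z.2 := by
  let ι : EuclideanSpace ℝ (Fin m) → Model p m := fun w => (0, w)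
  have hι : ContDiff ℝ ∞ ι := contDiff_const.prodMk contDiff_id
  have hι0 : Filter.Tendsto ι (𝓝 0) (𝓝 0) := eventually_tendsto_vertical
  let π (j : Fin m) : EuclideanSpace ℝ (Fin m) →L[ℝ] ℝ := EuclideanSpace.proj j
  let P : EuclideanSpace ℝ (Fin m) → EuclideanSpace ℝ (Fin m) →L[ℝ] EuclideanSpace ℝ (Fin p) :=
    fun w => ∑ j, (π j).smulRight (g j (ι w)).1
  let Q : EuclideanSpace ℝ (Fin m) → EuclideanSpace ℝ (Fin m) →L[ℝ] EuclideanSpace ℝ (Fin m) :=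
    fun w => ∑ j, (π j).smulRight (g j (ι w)).2
  have hgs : ∀ᶠ w in 𝓝 0, ∀ j, ContDiffAt ℝ ∞ (fun w => g j (ι w)) w :=
    Filter.eventually_all.2 fun j => (hι0.eventually (hg j)).mono fun w hw =>
      ContDiffAt.comp w (g := g j) hw hι.contDiffAt
  have hP : ∀ᶠ w in 𝓝 0, ContDiffAt ℝ ∞ P w := hgs.mono fun w hw =>
    ContDiffAt.sum fun j _ => contDiffAt_const.smulRight (contDiff_fst.contDiffAt.comp w (hw j))
  have hQ : ∀ᶠ w in 𝓝 0, ContDiffAt ℝ ∞ Q w := hgs.mono fun w hw =>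
    ContDiffAt.sum fun j _ => contDiffAt_const.smulRight (contDiff_snd.contDiffAt.comp w (hw j))
  have hQ0 : (Q 0).IsInvertible := isInvertible_sum_smulRight hli
  have hQi : ∀ᶠ w in 𝓝 0, (Q w).IsInvertible := by
    obtain ⟨e, he⟩ := hQ0
    have h1 := hQ.self_of_nhds.continuousAt.eventually_mem (he ▸ ContinuousLinearEquiv.nhds e)
    exact h1
  -- `P w` and `Q w` send coefficients to the `x`- and `w`-parts of the combination of the `g j (0,
  -- w)`, so the graph map is `P Q⁻¹`.
  let b : EuclideanSpace ℝ (Fin m) → EuclideanSpace ℝ (Fin m) →L[ℝ] EuclideanSpace ℝ (Fin p) :=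
    fun w => (P w).comp (Q w).inverse
  have hb : ∀ᶠ w in 𝓝 0, ContDiffAt ℝ ∞ b w := by
    filter_upwards [hP, hQ, hQi] with w hP hQ hQi
    exact hP.clm_comp (ContDiffAt.comp w (g := ContinuousLinearMap.inverse)
      hQi.contDiffAt_map_inverse hQ)
  have hbs : ∀ᶠ w in 𝓝 0, ∀ a : Fin m → ℝ,
      (∑ j, a j • g j (ι w)).1 = b w (∑ j, a j • g j (ι w)).2 := by
    filter_upwards [hQi] with w hw a
    have h1 : (∑ j, a j • g j (ι w)).1 = P w (WithLp.toLp 2 a) := by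
      simp [P, π, Prod.fst_sum]
    have h2 : (∑ j, a j • g j (ι w)).2 = Q w (WithLp.toLp 2 a) := by
      simp [Q, π, Prod.snd_sum]
    rw [h1, h2]
    obtain ⟨e, he⟩ := hw
    simp only [b, ContinuousLinearMap.comp_apply, ← he, ContinuousLinearMap.inverse_equiv]
    congr 1
    exact (e.symm_apply_apply _).symm
  have hfs : ∀ᶠ w in 𝓝 0, ContDiffAt ℝ ∞ (fun w => f (ι w)) w :=
    (hι0.eventually hf).mono fun w hw => ContDiffAt.comp w (g := f) hw hι.contDiffAt
  -- The offset `F` is the defect of `f (0, w)` from the graph; adding combinations of the `g j (0,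
  -- w)` does not change it.
  refine ⟨b, fun w => (f (ι w)).1 - b w (f (ι w)).2, hb, ?_, ?_⟩
  · filter_upwards [hb, hfs] with w hb hfs
    exact (contDiff_fst.contDiffAt.comp w hfs).sub
      (hb.clm_apply (contDiff_snd.contDiffAt.comp w hfs))
  · filter_upwards [hfg, tendsto_snd_zero.eventually hbs] with z hz hbz
    refine ⟨fun i => ?_, ?_⟩
    · obtain ⟨a, ha⟩ := hz.2 i
      rw [ha]
      exact hbz a
    · obtain ⟨a, ha⟩ := hz.1
      rw [ha, Prod.fst_add, Prod.snd_add, map_add, hbz a]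
      simp only [ι]
      abel

/-- The distribution of the graphs of `b` is integrable only if the derivative of `b` is
symmetric. -/
theorem fderiv_graph_symmetric
    {b : EuclideanSpace ℝ (Fin m) → EuclideanSpace ℝ (Fin m) →L[ℝ] EuclideanSpace ℝ (Fin p)}
    {V W : Model p m → Model p m} {z : Model p m} (hb : DifferentiableAt ℝ b z.2)
    (hV : DifferentiableAt ℝ V z) (hW : DifferentiableAt ℝ W z)
    (hVb : ∀ᶠ y in 𝓝 z, (V y).1 = b y.2 (V y).2) (hWb : ∀ᶠ y in 𝓝 z, (W y).1 = b y.2 (W y).2)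
    (hVW : (VectorField.lieBracket ℝ V W z).1 = b z.2 (VectorField.lieBracket ℝ V W z).2) :
    fderiv ℝ b z.2 (V z).2 (W z).2 = fderiv ℝ b z.2 (W z).2 (V z).2 := by
  -- Differentiating the graph equation produces a term in `Db`. In the bracket the remaining terms
  -- cancel by `hVW`, which leaves the antisymmetric part of `Db`.
  have key {X : Model p m → Model p m} (hX : DifferentiableAt ℝ X z)
      (hXb : ∀ᶠ y in 𝓝 z, (X y).1 = b y.2 (X y).2) (e : Model p m) :
      (fderiv ℝ X z e).1 = fderiv ℝ b z.2 e.2 (X z).2 + b z.2 (fderiv ℝ X z e).2 := by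
    have h1 := (ContinuousLinearMap.fst ℝ (EuclideanSpace ℝ (Fin p))
      (EuclideanSpace ℝ (Fin m))).hasFDerivAt.comp z hX.hasFDerivAt
    have h2 := (ContinuousLinearMap.snd ℝ (EuclideanSpace ℝ (Fin p))
      (EuclideanSpace ℝ (Fin m))).hasFDerivAt.comp z hX.hasFDerivAt
    have h3 : HasFDerivAt (fun y : Model p m => b y.2) ((fderiv ℝ b z.2).comp (.snd ℝ _ _)) z :=
      HasFDerivAt.comp z (g := b) hb.hasFDerivAt hasFDerivAt_snd
    have h4 := h1.unique ((h3.clm_apply h2).congr_of_eventuallyEq hXb)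
    have h5 := DFunLike.congr_fun h4 e
    simpa [add_comm] using h5
  rw [VectorField.lieBracket, Prod.fst_sub, Prod.snd_sub, map_sub, key hV hVb, key hW hWb] at hVW
  have h6 : fderiv ℝ b z.2 (V z).2 (W z).2 - fderiv ℝ b z.2 (W z).2 (V z).2 = 0 := by
    rw [← sub_eq_zero] at hVW
    rw [← hVW]
    abel
  exact sub_eq_zero.1 h6

theorem eq_flip_of_linearIndependent {V W : Type*} [NormedAddCommGroup V] [NormedSpace ℝ V]
    [NormedAddCommGroup W] [NormedSpace ℝ W] (T : V →L[ℝ] V →L[ℝ] W) {ι : Type*} {d : ι → V}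
    (hd : Submodule.span ℝ (Set.range d) = ⊤) (h : ∀ i j, T (d i) (d j) = T (d j) (d i)) (u v : V) :
    T u v = T v u := by
  have h1 (i : ι) : (T (d i)).toLinearMap = (T.flip (d i)).toLinearMap :=
    LinearMap.ext_on_range hd fun j => h i j
  have h2 : T.toLinearMap = T.flip.toLinearMap := LinearMap.ext_on_range hd fun i =>
    ContinuousLinearMap.coe_injective (h1 i)
  have h3 : T = T.flip := ContinuousLinearMap.coe_injective h2
  exact DFunLike.congr_fun (DFunLike.congr_fun h3 u) v

/-- The shear `(x, w) ↦ (x - B w, w)`. -/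
def shear {B : EuclideanSpace ℝ (Fin m) → EuclideanSpace ℝ (Fin p)} (hB : ContDiff ℝ ∞ B) :
    PartialDiffeomorph 𝓘(ℝ, Model p m) 𝓘(ℝ, Model p m) (Model p m) (Model p m) ∞ where
  toFun z := (z.1 - B z.2, z.2)
  invFun z := (z.1 + B z.2, z.2)
  source := Set.univ
  target := Set.univ
  map_source' _ _ := trivial
  map_target' _ _ := trivial
  left_inv' _ _ := by simp
  right_inv' _ _ := by simp
  open_source := isOpen_univ
  open_target := isOpen_univ
  contMDiffOn_toFun :=
    ((contDiff_fst.sub (hB.comp contDiff_snd)).prodMk contDiff_snd).contMDiff.contMDiffOn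
  contMDiffOn_invFun :=
    ((contDiff_fst.add (hB.comp contDiff_snd)).prodMk contDiff_snd).contMDiff.contMDiffOn

theorem fderiv_shear {B : EuclideanSpace ℝ (Fin m) → EuclideanSpace ℝ (Fin p)}
    (hB : ContDiff ℝ ∞ B) (z v : Model p m) :
    fderiv ℝ (shear hB) z v = (v.1 - fderiv ℝ B z.2 v.2, v.2) := by
  have h1 : HasFDerivAt (fun y : Model p m => B y.2) ((fderiv ℝ B z.2).comp (.snd ℝ _ _)) z :=
    HasFDerivAt.comp z (g := B) (hB.differentiable (by simp) z.2).hasFDerivAt hasFDerivAt_snd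
  have h2 : HasFDerivAt (shear hB) _ z := (hasFDerivAt_fst.sub h1).prodMk hasFDerivAt_snd
  rw [h2.fderiv]
  rfl

end Graph

/-! ### From abelian symmetry algebras to trivial systems. -/

section Trivialisation

variable {E : Type} [NormedAddCommGroup E] [NormedSpace ℝ E]
  {M : Type*} [TopologicalSpace M] [ChartedSpace E M]
  {p m : ℕ}

/-- A linear family of sections with prescribed values at a point. -/
theorem exists_linear_section [FiniteDimensional ℝ E] (hE : Module.finrank ℝ E = p + m)
    {x₀ : M} (𝔞 : Submodule ℝ ((x : M) → TangentSpace 𝓘(ℝ, E) x))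
    {G : Submodule ℝ (TangentSpace 𝓘(ℝ, E) x₀)} (hG : Module.finrank ℝ G = m)
    (hc : IsCompl (𝔞.map (LinearMap.proj x₀)) G) :
    ∃ (v : EuclideanSpace ℝ (Fin p) →ₗ[ℝ] (x : M) → TangentSpace 𝓘(ℝ, E) x)
      (e : Model p m ≃L[ℝ] TangentSpace 𝓘(ℝ, E) x₀),
      (∀ c, v c ∈ 𝔞) ∧ ∀ c, e (c, 0) = v c x₀ := by
  have hfd : FiniteDimensional ℝ (TangentSpace 𝓘(ℝ, E) x₀) :=
    inferInstanceAs (FiniteDimensional ℝ E)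
  have hT2 : T2Space (TangentSpace 𝓘(ℝ, E) x₀) := inferInstanceAs (T2Space E)
  set A : Submodule ℝ (TangentSpace 𝓘(ℝ, E) x₀) := 𝔞.map (LinearMap.proj x₀)
  have hA : Module.finrank ℝ A = p := by
    have h1 := Submodule.finrank_add_eq_of_isCompl hc
    have h2 : Module.finrank ℝ (TangentSpace 𝓘(ℝ, E) x₀) = p + m := hE
    omega
  let eA : EuclideanSpace ℝ (Fin p) ≃ₗ[ℝ] A := LinearEquiv.ofFinrankEq _ _ (by simp [hA])
  let eG : EuclideanSpace ℝ (Fin m) ≃ₗ[ℝ] G := LinearEquiv.ofFinrankEq _ _ (by simp [hG])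
  let π : 𝔞 →ₗ[ℝ] A := LinearMap.submoduleMap (LinearMap.proj x₀) 𝔞
  -- Evaluation at `x₀` need not be injective on `𝔞`; a linear section of it selects a
  -- `p`-dimensional space of symmetries.
  obtain ⟨s, hs⟩ := π.exists_rightInverse_of_surjective
    (LinearMap.range_eq_top.2 (LinearMap.submoduleMap_surjective _ _))
  refine ⟨𝔞.subtype ∘ₗ s ∘ₗ eA.toLinearMap,
    ((eA.prodCongr eG).trans (Submodule.prodEquivOfIsCompl A G hc)).toContinuousLinearEquiv,
    fun c => (s (eA c)).2, fun c => ?_⟩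
  have h1 : π (s (eA c)) = eA c := DFunLike.congr_fun hs (eA c)
  have h2 := congrArg Subtype.val h1
  refine Eq.trans ?_ h2.symm
  change ((eA c : TangentSpace 𝓘(ℝ, E) x₀) + (eG 0 : TangentSpace 𝓘(ℝ, E) x₀)) = _
  rw [map_zero]
  exact add_zero _

variable [IsManifold 𝓘(ℝ, E) ∞ M] {S : System 𝓘(ℝ, E) M m}

/-- A combination of the `g i` without `w`-part is the value of a vector of `A`, so it lies in `A ∩
𝒢 = 0`. -/
theorem linearIndependent_snd_of_disjoint
    {φ : PartialDiffeomorph 𝓘(ℝ, E) 𝓘(ℝ, Model p m) M (Model p m) ∞} {x₀ : M}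
    (hx₀ : x₀ ∈ φ.source) (hli : LinearIndependent ℝ fun i => S.g i x₀)
    {A : Submodule ℝ (TangentSpace 𝓘(ℝ, E) x₀)} (hA : Disjoint A (S.G x₀))
    (hφ : ∀ c, ∃ y ∈ A, differentialAt φ x₀ y = (c, 0)) :
    LinearIndependent ℝ fun i => (differentialAt φ x₀ (S.g i x₀)).2 := by
  rw [Fintype.linearIndependent_iff] at hli ⊢
  intro a ha
  refine hli a ?_
  obtain ⟨y, hyA, hy⟩ := hφ (differentialAt φ x₀ (∑ i, a i • S.g i x₀)).1
  have h1 : y = ∑ i, a i • S.g i x₀ := by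
    refine differentialAt_injective φ hx₀ (hy.trans (Prod.ext rfl ?_))
    rw [map_sum, Prod.snd_sum]
    simpa using ha.symm
  have h2 : ∑ i, a i • S.g i x₀ ∈ S.G x₀ :=
    Submodule.sum_mem _ fun i _ => Submodule.smul_mem _ _ (Submodule.subset_span ⟨i, rfl⟩)
  rw [← h1] at h2 ⊢
  exact Submodule.disjoint_def.1 hA y hyA h2

/-- An involutive distribution spanned by graphs `dx = b(w) dw` has symmetric derivative of `b`. -/
theorem System.InvolutiveOn.eventually_symmetric {U : Set M}
    (hinv : S.InvolutiveOn U) {φ : PartialDiffeomorph 𝓘(ℝ, E) 𝓘(ℝ, Model p m) M (Model p m) ∞}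
    (hφU : φ.source ⊆ U) (h0 : 0 ∈ φ.target)
    (hli : LinearIndependent ℝ fun i => (pushField φ (S.g i) 0).2)
    {b : EuclideanSpace ℝ (Fin m) → EuclideanSpace ℝ (Fin m) →L[ℝ] EuclideanSpace ℝ (Fin p)}
    (hb : ∀ᶠ w in 𝓝 0, ContDiffAt ℝ ∞ b w)
    (hgb : ∀ᶠ z in 𝓝 (0 : Model p m), ∀ i,
      (pushField φ (S.g i) z).1 = b z.2 (pushField φ (S.g i) z).2) :
    ∀ᶠ w in 𝓝 0, ∀ u v, fderiv ℝ b w u v = fderiv ℝ b w v u := by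
  have hgs (i : Fin m) {z : Model p m} (hz : z ∈ φ.target) :
      ContDiffAt ℝ ∞ (pushField φ (S.g i)) z := by
    have h1 := contDiffAt_pushField φ (S.smooth_g i) isOpen_univ (symm_mem_source φ hz) trivial
    rwa [apply_symm_apply φ hz] at h1
  have hliz : ∀ᶠ z in 𝓝 (0 : Model p m),
      LinearIndependent ℝ fun i => (pushField φ (S.g i) z).2 := by
    have h1 : ContinuousAt (fun z => fun i => (pushField φ (S.g i) z).2) (0 : Model p m) :=
      continuousAt_pi.2 fun i => continuous_snd.continuousAt.comp (hgs i h0).continuousAt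
    exact h1.eventually (isOpen_setOfPred_linearIndependent.mem_nhds hli)
  filter_upwards [hb, eventually_tendsto_vertical.eventually hliz,
    eventually_tendsto_vertical.eventually hgb.eventually_nhds,
    eventually_tendsto_vertical.eventually (φ.open_target.mem_nhds h0)] with w hb hli hgb hzt
  refine eq_flip_of_linearIndependent _ (hli.span_eq_top_of_card_eq_finrank' (by simp))
    fun i j => ?_
  -- Since `b` depends on `w` only, it suffices to test at the points `(0, w)`.
  refine fderiv_graph_symmetric (z := (0, w)) (hb.differentiableAt (by simp))
    ((hgs i hzt).differentiableAt (by simp)) ((hgs j hzt).differentiableAt (by simp))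
    (hgb.mono fun z hz => hz i) (hgb.mono fun z hz => hz j) ?_
  set x := φ.symm (0, w) with hx
  have hxs : x ∈ φ.source := symm_mem_source φ hzt
  have hφx : φ x = (0, w) := apply_symm_apply φ hzt
  have h1 := hinv (S.g i) (S.g j) ((S.smooth_g i).mono (Set.subset_univ U))
    ((S.smooth_g j).mono (Set.subset_univ U)) (fun y _ => Submodule.subset_span ⟨i, rfl⟩)
    (fun y _ => Submodule.subset_span ⟨j, rfl⟩) x (hφU hxs)
  obtain ⟨a, ha⟩ := (Submodule.mem_span_range_iff_exists_fun ℝ).1 h1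
  have h2 := mfderiv_mlieBracket φ (S.smooth_g i) (S.smooth_g j) isOpen_univ hxs trivial
  have h3 : differentialAt φ x (∑ k, a k • S.g k x) =
      VectorField.lieBracket ℝ (pushField φ (S.g i)) (pushField φ (S.g j)) (φ x) := by
    rw [ha]
    exact h2
  rw [hφx] at h3
  have h4 (k : Fin m) := hgb.self_of_nhds k
  have h5 (k : Fin m) : differentialAt φ x (S.g k x) = pushField φ (S.g k) (0, w) := rfl
  rw [← h3, map_sum, Prod.fst_sum, Prod.snd_sum, map_sum]
  refine Finset.sum_congr rfl fun k _ => ?_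
  rw [map_smul, Prod.smul_fst, Prod.smul_snd, map_smul, h5, h4]

/-- After straightening, `𝒢` is `dx = b(w) dw` with `b = dB`. The shear by `B` subtracts `b(w) dw`
from `dx`, which makes `𝒢` vertical and reduces the horizontal drift to the offset of `𝒜` from the
graph, a function of `w`. -/
theorem exists_isNormalForm_of_abelian [FiniteDimensional ℝ E]
    (hE : Module.finrank ℝ E = p + m) {x₀ : M} {U : Set M}
    (hU : IsOpen U) (hx₀ : x₀ ∈ U) (hinv : S.InvolutiveOn U)
    (hrk : ∀ x ∈ U, Module.finrank ℝ (S.G x) = m)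
    {𝔞 : Submodule ℝ ((x : M) → TangentSpace 𝓘(ℝ, E) x)} (h𝔞 : S.IsAbelianSymmetryAlgebraOn U 𝔞)
    (hc : IsCompl (𝔞.map (LinearMap.proj x₀)) (S.G x₀)) :
    ∃ (F : EuclideanSpace ℝ (Fin m) → EuclideanSpace ℝ (Fin p))
      (φ : PartialDiffeomorph 𝓘(ℝ, E) 𝓘(ℝ, Model p m) M (Model p m) ∞),
      ContDiff ℝ ∞ F ∧ x₀ ∈ φ.source ∧ IsNormalForm S (fun z => F z.2) φ := by
  have hli : ∀ x ∈ U, LinearIndependent ℝ fun i => S.g i x := fun x hx =>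
    linearIndependent_iff_card_eq_finrank_span.2 ((Fintype.card_fin m).trans (hrk x hx).symm)
  obtain ⟨v, e, hv𝔞, he⟩ := exists_linear_section hE 𝔞 (hrk x₀ hx₀) hc
  obtain ⟨φ, hφ0, hφU, hφx, hφv⟩ := exists_straightening v hU (fun c => (h𝔞.1 _ (hv𝔞 c)).1)
    (fun c d => h𝔞.2 _ (hv𝔞 c) _ (hv𝔞 d)) hx₀ e he
  have h0 : 0 ∈ φ.target := hφx ▸ apply_mem_target φ hφ0
  have hli0 : LinearIndependent ℝ fun i => (pushField φ (S.g i) 0).2 := by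
    have h1 := linearIndependent_snd_of_disjoint hφ0 (hli x₀ hx₀) hc.disjoint fun c =>
      ⟨v c x₀, ⟨v c, hv𝔞 c, rfl⟩, hφv x₀ hφ0 c⟩
    simp only [← pushField_eq_differentialAt φ _ hφ0, hφx] at h1
    exact h1
  have hs {X : (x : M) → TangentSpace 𝓘(ℝ, E) x} (hX : SmoothFieldOn 𝓘(ℝ, E) X Set.univ) :
      ∀ᶠ z in 𝓝 0, ContDiffAt ℝ ∞ (pushField φ X) z := by
    filter_upwards [φ.open_target.mem_nhds h0] with z hz
    have h1 := contDiffAt_pushField φ hX isOpen_univ (symm_mem_source φ hz) trivial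
    rwa [apply_symm_apply φ hz] at h1
  obtain ⟨b, F, hb, hF, hbF⟩ := exists_graph (hs S.smooth_f) (fun i => hs (S.smooth_g i)) hli0
    (eventually_exists_eq_sum hφU (fun c => h𝔞.1 _ (hv𝔞 c)) hφv h0)
  obtain ⟨B, hB, hBb⟩ := exists_primitive hb
    (hinv.eventually_symmetric hφU h0 hli0 hb (hbF.mono fun z hz => hz.1))
  obtain ⟨F', hF', hFF'⟩ := exists_contDiff_eventuallyEq hF
  have hev : ∀ᶠ z in 𝓝 (0 : Model p m), ((∀ i,
      (pushField φ (S.g i) z).1 = b z.2 (pushField φ (S.g i) z).2) ∧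
      (pushField φ S.f z).1 = b z.2 (pushField φ S.f z).2 + F z.2) ∧
      fderiv ℝ B z.2 = b z.2 ∧ F' z.2 = F z.2 :=
    hbF.and ((tendsto_snd_zero.eventually hBb).and (tendsto_snd_zero.eventually hFF'))
  have hφc : Filter.Tendsto φ (𝓝 x₀) (𝓝 0) := by
    have h1 := (contMDiffAt φ hφ0).continuousAt
    rwa [ContinuousAt, hφx] at h1
  set s : Set M := interior {x | ∀ z, z = φ x → ((∀ i,
      (pushField φ (S.g i) z).1 = b z.2 (pushField φ (S.g i) z).2) ∧
      (pushField φ S.f z).1 = b z.2 (pushField φ S.f z).2 + F z.2) ∧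
      fderiv ℝ B z.2 = b z.2 ∧ F' z.2 = F z.2} with hsdef
  have hx₀s : x₀ ∈ s := mem_interior_iff_mem_nhds.2
    ((hφc.eventually hev).mono fun x hx z hz => hz ▸ hx)
  have hD (x : M) (hx : x ∈ φ.source) (y : TangentSpace 𝓘(ℝ, E) x) :=
    (differentialAt_trans φ (shear hB) hx trivial y).trans (fderiv_shear hB _ _)
  refine ⟨F', restrictOpen (φ.trans (shear hB)) s isOpen_interior, hF', ⟨⟨hφ0, trivial⟩, hx₀s⟩,
    ⟨fun x hx => hli x (hφU hx.1.1), fun x hx i => ?_, fun x hx => ?_⟩⟩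
  · obtain ⟨⟨h1, -⟩, h2, -⟩ := interior_subset hx.2 _ rfl
    refine (congrArg Prod.fst (hD x hx.1.1 _)).trans ?_
    have h3 := h1 i
    rw [pushField_eq_differentialAt φ _ hx.1.1] at h3
    rw [h2, h3, sub_self]
  · obtain ⟨⟨-, h1⟩, h2, h3⟩ := interior_subset hx.2 _ rfl
    refine (congrArg Prod.fst (hD x hx.1.1 _)).trans ?_
    rw [pushField_eq_differentialAt φ _ hx.1.1] at h1
    change _ = F' (φ x).2
    rw [h2, h1, h3, add_sub_cancel_left]

end Trivialisation

end ControlAffine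
end

/-! ### Both characterisations. -/

theorem mainTheorem2 {n m : ℕ} (hm : 1 ≤ m) {M : Type*} [TopologicalSpace M] [T2Space M]
    [ChartedSpace (EuclideanSpace ℝ (Fin n)) M] [IsManifold (𝓡 n) ∞ M]
    (S : ControlAffine.System (𝓡 n) M m) (x₀ : M) :
    (∀ k : ℕ, (∀ᶠ x in 𝓝 x₀, Module.finrank ℝ (S.G1 x) = m + k) →
      (S.LocallyTrivialisable x₀ ↔
        ∃ (h : ControlAffine.Model (n - m) m → EuclideanSpace ℝ (Fin (n - m)))
          (hh : ContDiff ℝ ∞ h) (z₀ : ControlAffine.Model (n - m) m),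
          S.LocallyFeedbackEquivalent x₀ (ControlAffine.extendedSystem h hh) z₀ ∧
          ∀ᶠ z in 𝓝 z₀, Module.finrank ℝ
            (Submodule.span ℝ (Set.range fun i => fderiv ℝ (fun y => h y i) z)) = k)) ∧
    (S.LocallyTrivialisable x₀ ↔
      ∃ U : Set M, IsOpen U ∧ x₀ ∈ U ∧ S.InvolutiveOn U ∧
        (∀ x ∈ U, Module.finrank ℝ (S.G x) = m) ∧
        ∃ 𝔞 : Submodule ℝ ((x : M) → TangentSpace (𝓡 n) x),
          S.IsAbelianSymmetryAlgebraOn U 𝔞 ∧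
          IsCompl (𝔞.map (LinearMap.proj x₀)) (S.G x₀)) := by
  refine ⟨fun k hk => ControlAffine.locallyTrivialisable_iff_constant_rank S x₀ k hk, ?_, ?_⟩
  · rintro ⟨F, hF, z₀, h⟩
    obtain ⟨φ, hx₀, -, hφ⟩ :=
      (ControlAffine.locallyFeedbackEquivalent_extendedSystem_iff _).1 h
    exact hφ.exists_abelian hx₀
  · rintro ⟨U, hU, hx₀, hinv, hrk, 𝔞, h𝔞, hc⟩
    -- The subtraction `n - m` is truncated; the rank of `𝒢` gives `m ≤ n`, so that `(n - m) + m =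
    -- n`.
    have hle : m ≤ n := by
      have hfd : FiniteDimensional ℝ (TangentSpace (𝓡 n) x₀) :=
        inferInstanceAs (FiniteDimensional ℝ (EuclideanSpace ℝ (Fin n)))
      have h1 : Module.finrank ℝ (S.G x₀) ≤ Module.finrank ℝ (EuclideanSpace ℝ (Fin n)) :=
        (S.G x₀).finrank_le
      rwa [hrk x₀ hx₀, finrank_euclideanSpace, Fintype.card_fin] at h1
    obtain ⟨F, φ, hF, hφx, hφ⟩ := ControlAffine.exists_isNormalForm_of_abelian (p := n - m)
      (by rw [finrank_euclideanSpace, Fintype.card_fin, Nat.sub_add_cancel hle]) hU hx₀ hinv hrk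
      h𝔞 hc
    exact ⟨F, hF, φ x₀, hφ.locallyFeedbackEquivalent (hF.comp contDiff_snd) hφx⟩
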